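/- Let $k$ be a perfect field of characteristic $p>0$, and let $X=\operatorname{Spec} A$ be an affine integral scheme essentially smooth over $k$, i.e. $A$ is a domain which is a localisation of a smooth $k$-algebra; in particular $X$ is noetherian and normal. Let $D$ be an $\mathbb{R}$-divisor on $X$, i.e. a finite formal $\mathbb{R}$-linear combination of prime divisors, and let $\{D\}=D-\lfloor D\rfloor$ be its fractional part. Assume that $\operatorname{Supp}\{D\}$ is simple normal crossing: for every point $x\in X$ there is a regular system of parameters $t_1,\dots,t_d$ of the regular local ring $\mathcal{O}_{X,x}$ such that every irreducible component of $\operatorname{Supp}\{D\}$ passing through $x$ is defined at $x$ by one of the $t_i$. For an integer $n\ge 1$, let $W_nX$ be the scheme of $p$-typical Witt vectors of length $n$ over $X$, whose structure sheaf $W_n\mathcal{O}_X$ has stalk $W_n(\mathcal{O}_{X,x})$ at $x\in X$. Let $W_n\mathcal{O}_X(D)$ be the Witt divisorial sheaf, i.e. the $W_n\mathcal{O}_X$-submodule of the constant sheaf $W_n(K(X))$ given, for non-empty open subsets $U\subseteq X$, by $$\Gamma(U,W_n\mathcal{O}_X(D))=\{(\varphi_0,\dots,\varphi_{n-1})\in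 W_n(K(X)) : (\operatorname{div}(\varphi_i)+p^iD)|_U\ge 0 \text{ for } 0\le i\le n-1\},$$ where the condition on $\varphi_i$ is regarded as satisfied if $\varphi_i=0$. Then for every integer $n\ge 1$, $W_n\mathcal{O}_X(D)$ is a Cohen--Macaulay $W_n\mathcal{O}_X$-module: for every $x\in X$, the ring $W_n(\mathcal{O}_{X,x})$ is a noetherian local ring, and the stalk $W_n\mathcal{O}_X(D)_x$ is a finitely generated $W_n(\mathcal{O}_{X,x})$-module which is either zero or has depth equal to its Krull dimension. -/

import Mathlib

universe u v

namespace WittDivisorial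

section Normality

open TensorProduct nonZeroDivisors

attribute [local instance] Algebra.TensorProduct.rightAlgebra in
theorem isIntegrallyClosed_of_toIntegralClosure (P T : Type*) [CommRing P] [IsDomain P]
    [IsIntegrallyClosed P] [CommRing T] [IsDomain T] [Algebra P T] [Module.Flat P T]
    [Algebra.FormallyUnramified P T] [Algebra.EssFiniteType P T]
    (H : Function.Bijective (TensorProduct.toIntegralClosure P T (FractionRing P))) :
    IsIntegrallyClosed T := by
  let L := FractionRing P
  let E := T ⊗[P] L
  have hinj : Function.Injective (algebraMap P T) := FaithfulSMul.algebraMap_injective P T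
  have hle : Algebra.algebraMapSubmonoid T P⁰ ≤ T⁰ :=
    map_le_nonZeroDivisors_of_injective _ hinj le_rfl
  have hloc : IsLocalization (Algebra.algebraMapSubmonoid T P⁰) E := inferInstance
  have hdom : IsDomain E := IsLocalization.isDomain_of_le_nonZeroDivisors _ hle
  have h1 : IsDomain (L ⊗[P] T) := (Algebra.TensorProduct.comm P L T).toMulEquiv.isDomain E
  have h2 : Module.Finite L (L ⊗[P] T) := Algebra.FormallyUnramified.finite_of_free L (L ⊗[P] T)
  have h3 : IsField (L ⊗[P] T) := isField_of_isIntegral_of_isField' (Field.toIsField L)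
  have h4 : IsField E := (Algebra.TensorProduct.comm P L T).symm.toMulEquiv.isField h3
  have h5 : IsFractionRing T E := by
    let _ : Field E := h4.toField
    have hTE : Function.Injective (algebraMap T E) := IsLocalization.injective E hle
    have : FaithfulSMul T E := (faithfulSMul_iff_algebraMap_injective T E).mpr hTE
    have key : @IsFractionRing T _ E _ _ := by
      refine IsFractionRing.of_field T E fun z => ?_
      obtain ⟨a, s, rfl⟩ := IsLocalization.exists_mk'_eq (Algebra.algebraMapSubmonoid T P⁰) z
      refine ⟨a, s, ?_⟩
      have hs : algebraMap T E s ≠ 0 := by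
        intro h
        have := hTE (h.trans (map_zero _).symm)
        exact nonZeroDivisors.ne_zero (hle s.2) this
      rw [eq_div_iff hs]
      exact IsLocalization.mk'_spec _ _ _
    exact key
  rw [isIntegrallyClosed_iff E]
  intro z hz
  obtain ⟨w, hw⟩ := H.2 ⟨z, hz⟩
  have hw' : z = (TensorProduct.toIntegralClosure P T (FractionRing P) w : E) := by rw [hw]
  clear hw
  rw [hw']
  clear hw' hz
  induction w with
  | zero => exact ⟨0, by simp⟩
  | add x y hx hy =>
    obtain ⟨a, ha⟩ := hx
    obtain ⟨b, hb⟩ := hy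
    exact ⟨a + b, by rw [map_add, map_add, ha, hb]; rfl⟩
  | tmul t y =>
    obtain ⟨c, hc⟩ := (isIntegrallyClosed_iff L).mp ‹_› y.2
    refine ⟨t * algebraMap P T c, ?_⟩
    simp only [TensorProduct.toIntegralClosure, Algebra.TensorProduct.map_tmul,
      AlgHom.coe_codRestrict, AlgHom.coe_id, id, Subalgebra.coe_val]
    rw [← hc, mul_comm, ← Algebra.smul_def, Algebra.algebraMap_eq_smul_one c]
    exact TensorProduct.smul_tmul c t 1

theorem isIntegrallyClosed_of_isLocalization_smooth (k A B : Type*) [Field k]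
    [CommRing A] [IsDomain A] [CommRing B] [Algebra k B] [Algebra.Smooth k B] [Algebra B A]
    (M : Submonoid B) [IsLocalization M A] : IsIntegrallyClosed A := by
  rw [isIntegrallyClosed_iff (FractionRing A)]
  intro x hx
  let I : Ideal A := (1 : Submodule A (FractionRing A)).colon {x}
  by_cases hI : I = ⊤
  · have : (1 : A) ∈ I := hI ▸ Submodule.mem_top
    simpa [I, Submodule.mem_colon_singleton, Submodule.mem_one] using this
  exfalso
  obtain ⟨m, hm, hIm⟩ := Ideal.exists_le_maximal I hI
  let q : Ideal B := m.comap (algebraMap B A)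
  have hq : q.IsPrime := inferInstance
  obtain ⟨f, hfq, n, _, _, _⟩ :=
    Algebra.IsSmoothAt.exists_isStandardEtale_mvPolynomial (R := k) (p := q)
  let P := MvPolynomial (Fin n) k
  let Bf := Localization.Away f
  let g : A := algebraMap B A f
  have hg : g ∉ m := hfq
  let T := Localization.Away g
  have hg0 : Submonoid.powers g ≤ A⁰ := by
    rw [Submonoid.powers_le]
    exact mem_nonZeroDivisors_of_ne_zero fun h => hg (h ▸ m.zero_mem)
  have : IsDomain T := IsLocalization.isDomain_of_le_nonZeroDivisors _ hg0
  let φ : Bf →+* T := IsLocalization.Away.lift (S := Bf) f (g := algebraMap B T) (by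
    rw [IsScalarTower.algebraMap_apply B A T]
    exact IsLocalization.Away.algebraMap_isUnit g)
  let _ : Algebra Bf T := φ.toAlgebra
  have : IsScalarTower B Bf T := IsScalarTower.of_algebraMap_eq' <|
    (IsLocalization.Away.lift_comp (S := Bf) f (g := algebraMap B T) _).symm
  have : IsLocalization (Algebra.algebraMapSubmonoid A (Submonoid.powers f)) T := by
    rw [Algebra.algebraMapSubmonoid, Submonoid.map_powers]
    infer_instance
  have hloc : IsLocalization (Algebra.algebraMapSubmonoid Bf M) T :=
    IsLocalization.commutes Bf A T (Submonoid.powers f) M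
  let _ : Algebra P T := ((algebraMap Bf T).comp (algebraMap P Bf)).toAlgebra
  have : IsScalarTower P Bf T := IsScalarTower.of_algebraMap_eq' rfl
  have : Algebra.FormallyEtale Bf T :=
    Algebra.FormallyEtale.of_isLocalization (Algebra.algebraMapSubmonoid Bf M)
  have : Algebra.EssFiniteType Bf T :=
    Algebra.EssFiniteType.of_isLocalization T (Algebra.algebraMapSubmonoid Bf M)
  have : Module.Flat Bf T := IsLocalization.flat T (Algebra.algebraMapSubmonoid Bf M)
  have : Algebra.Etale P Bf := inferInstance
  have : Module.Flat P Bf := inferInstance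
  have : Module.Flat P T := Module.Flat.trans P Bf T
  have : Algebra.FormallyUnramified P T := Algebra.FormallyUnramified.comp P Bf T
  have : Algebra.EssFiniteType P T := Algebra.EssFiniteType.comp P Bf T
  have hT : IsIntegrallyClosed T := isIntegrallyClosed_of_toIntegralClosure P T
    (TensorProduct.toIntegralClosure_bijective_of_tower (S := Bf)
      TensorProduct.toIntegralClosure_bijective_of_smooth
      (TensorProduct.toIntegralClosure_bijective_of_isLocalization
        (Algebra.algebraMapSubmonoid Bf M)))
  let K := FractionRing A
  let ψ : T →+* K := IsLocalization.lift (M := Submonoid.powers g) (g := algebraMap A K)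
    fun y => IsUnit.mk0 _ fun h => nonZeroDivisors.ne_zero (hg0 y.2)
      (IsFractionRing.injective A K (h.trans (map_zero _).symm))
  let _ : Algebra T K := ψ.toAlgebra
  have : IsScalarTower A T K := IsScalarTower.of_algebraMap_eq' (IsLocalization.lift_comp _).symm
  have : IsFractionRing T K := IsFractionRing.isFractionRing_of_isDomain_of_isLocalization
    (Submonoid.powers g) T K
  obtain ⟨t, ht⟩ := (isIntegrallyClosed_iff K).mp hT (hx.tower_top (A := T))
  obtain ⟨a, s, rfl⟩ := IsLocalization.exists_mk'_eq (Submonoid.powers g) t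
  have hsI : (s : A) ∈ I := by
    rw [Submodule.mem_colon_singleton, Submodule.mem_one]
    refine ⟨a, ?_⟩
    rw [← ht, Algebra.smul_def, IsScalarTower.algebraMap_apply A T K,
      IsScalarTower.algebraMap_apply A T K, ← map_mul, IsLocalization.mk'_spec']
  obtain ⟨j, hj⟩ := s.2
  have := hIm hsI
  rw [← hj] at this
  exact hg (hm.isPrime.mem_of_pow_mem j this)

end Normality

theorem coeff_out_mem {p : ℕ} {K : Type*} [CommRing K] {n : ℕ} {O : ℕ → AddSubgroup K}
    {x : TruncatedWittVector p n K}
    (hx : ∀ i : Fin n, x.coeff i ∈ O i) (i : ℕ) : x.out.coeff i ∈ O i := by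
  by_cases h : i < n
  · have := TruncatedWittVector.coeff_out x ⟨i, h⟩
    simp only at this
    rw [this]; exact hx ⟨i, h⟩
  · simp [TruncatedWittVector.out, h]

section Witt

variable {p : ℕ} [hp : Fact p.Prime]

theorem teichmuller_mul_aux₁ {R : Type*} (r : MvPolynomial R ℚ)
    (x : WittVector p (MvPolynomial R ℚ)) :
    WittVector.teichmuller p r * x = WittVector.mk p fun n => r ^ p ^ n * x.coeff n := by
  apply (WittVector.ghostMap.bijective_of_invertible p (MvPolynomial R ℚ)).1
  rw [map_mul]
  ext1 n
  simp only [Pi.mul_apply, WittVector.ghostMap_apply, WittVector.ghostComponent_teichmuller]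
  simp only [WittVector.ghostComponent_apply, aeval_wittPolynomial, WittVector.coeff_mk, Finset.mul_sum]
  refine Finset.sum_congr rfl fun i hi => ?_
  rw [mul_pow, ← pow_mul, ← pow_add, Nat.add_sub_cancel' (Finset.mem_range_succ_iff.mp hi)]
  ring

theorem teichmuller_mul_aux₂ {R : Type*} (r : MvPolynomial R ℤ)
    (x : WittVector p (MvPolynomial R ℤ)) :
    WittVector.teichmuller p r * x = WittVector.mk p fun n => r ^ p ^ n * x.coeff n := by
  refine WittVector.map_injective (MvPolynomial.map (Int.castRingHom ℚ))
    (MvPolynomial.map_injective _ Int.cast_injective) ?_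
  rw [map_mul, WittVector.map_teichmuller, teichmuller_mul_aux₁]
  ext n
  simp [WittVector.map_coeff]

theorem teichmuller_mul_coeff {R : Type*} [CommRing R] (r : R) (x : WittVector p R) (n : ℕ) :
    (WittVector.teichmuller p r * x).coeff n = r ^ p ^ n * x.coeff n := by
  rcases MvPolynomial.counit_surjective R r with ⟨r, rfl⟩
  rcases WittVector.map_surjective (p := p) _ (MvPolynomial.counit_surjective R) x with ⟨x, rfl⟩
  rw [← WittVector.map_teichmuller, ← map_mul, teichmuller_mul_aux₂]
  simp [WittVector.map_coeff]

variable {K : Type*} [CommRing K]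

/-- The subring `⨁ₘ O m · Xᵐ` of `K[X]`, for a multiplicative family `O` of additive subgroups. -/
def gradedSubring (O : ℕ → AddSubgroup K) (h1 : (1 : K) ∈ O 0)
    (hmul : ∀ m n a b, a ∈ O m → b ∈ O n → a * b ∈ O (m + n)) : Subring (Polynomial K) where
  carrier := {f | ∀ m, f.coeff m ∈ O m}
  one_mem' m := by
    rw [Polynomial.coeff_one]
    split_ifs with h
    · rw [h]; exact h1
    · exact zero_mem _
  zero_mem' m := by simp
  add_mem' hf hg m := by rw [Polynomial.coeff_add]; exact add_mem (hf m) (hg m)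
  neg_mem' hf m := by rw [Polynomial.coeff_neg]; exact neg_mem (hf m)
  mul_mem' hf hg m := by
    rw [Polynomial.coeff_mul]
    refine sum_mem fun ij hij => ?_
    rw [← Finset.HasAntidiagonal.mem_antidiagonal.mp hij]
    exact hmul _ _ _ _ (hf _) (hg _)

theorem coeff_mem_of_lift {O : ℕ → AddSubgroup K} {h1 : (1 : K) ∈ O 0}
    {hmul : ∀ m n a b, a ∈ O m → b ∈ O n → a * b ∈ O (m + n)}
    {x : WittVector p K} (z : WittVector p (gradedSubring O h1 hmul))
    (hz : WittVector.map (gradedSubring O h1 hmul).subtype z =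
      WittVector.teichmuller p Polynomial.X * WittVector.map Polynomial.C x) (i : ℕ) :
    x.coeff i ∈ O (p ^ i) := by
  have h := congrArg (fun w => (WittVector.coeff w i).coeff (p ^ i)) hz
  simp only [teichmuller_mul_coeff, WittVector.map_coeff, Polynomial.coeff_X_pow_mul',
    le_refl, if_true, Nat.sub_self, Polynomial.coeff_C_zero] at h
  rw [← h]
  exact (z.coeff i).2 _

theorem exists_lift {O : ℕ → AddSubgroup K} {h1 : (1 : K) ∈ O 0}
    {hmul : ∀ m n a b, a ∈ O m → b ∈ O n → a * b ∈ O (m + n)}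
    {x : WittVector p K} (hx : ∀ i, x.coeff i ∈ O (p ^ i)) :
    ∃ z : WittVector p (gradedSubring O h1 hmul),
      WittVector.map (gradedSubring O h1 hmul).subtype z =
        WittVector.teichmuller p Polynomial.X * WittVector.map Polynomial.C x := by
  refine ⟨WittVector.mk p fun i => ⟨Polynomial.X ^ p ^ i * Polynomial.C (x.coeff i),
    fun m => ?_⟩, ?_⟩
  · rw [mul_comm, Polynomial.coeff_C_mul_X_pow]
    split_ifs with h
    · rw [h]; exact hx i
    · exact zero_mem _
  · ext1 i
    simp [WittVector.map_coeff, teichmuller_mul_coeff]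

theorem exists_lift_zero {O : ℕ → AddSubgroup K} {h1 : (1 : K) ∈ O 0}
    {hmul : ∀ m n a b, a ∈ O m → b ∈ O n → a * b ∈ O (m + n)}
    {x : WittVector p K} (hx : ∀ i, x.coeff i ∈ O 0) :
    ∃ z : WittVector p (gradedSubring O h1 hmul),
      WittVector.map (gradedSubring O h1 hmul).subtype z = WittVector.map Polynomial.C x := by
  refine ⟨WittVector.mk p fun i => ⟨Polynomial.C (x.coeff i), fun m => ?_⟩, ?_⟩
  · rw [Polynomial.coeff_C]
    split_ifs with h
    · rw [h]; exact hx i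
    · exact zero_mem _
  · ext1 i
    simp [WittVector.map_coeff]

/-- Witt vectors with `i`-th coefficient in `O (p ^ i)` are stable under addition, negation, and
multiplication by Witt vectors with coefficients in `O 0`. -/
theorem witt_add_mem (O : ℕ → AddSubgroup K) (h1 : (1 : K) ∈ O 0)
    (hmul : ∀ m n a b, a ∈ O m → b ∈ O n → a * b ∈ O (m + n)) {x y : WittVector p K}
    (hx : ∀ i, x.coeff i ∈ O (p ^ i)) (hy : ∀ i, y.coeff i ∈ O (p ^ i)) (i : ℕ) :
    (x + y).coeff i ∈ O (p ^ i) := by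
  obtain ⟨z, hz⟩ := exists_lift (h1 := h1) (hmul := hmul) hx
  obtain ⟨w, hw⟩ := exists_lift (h1 := h1) (hmul := hmul) hy
  exact coeff_mem_of_lift (z + w) (by rw [map_add, hz, hw, map_add, mul_add]) i

theorem witt_neg_mem (O : ℕ → AddSubgroup K) (h1 : (1 : K) ∈ O 0)
    (hmul : ∀ m n a b, a ∈ O m → b ∈ O n → a * b ∈ O (m + n)) {x : WittVector p K}
    (hx : ∀ i, x.coeff i ∈ O (p ^ i)) (i : ℕ) : (-x).coeff i ∈ O (p ^ i) := by
  obtain ⟨z, hz⟩ := exists_lift (h1 := h1) (hmul := hmul) hx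
  exact coeff_mem_of_lift (-z) (by rw [map_neg, hz, map_neg, mul_neg]) i

theorem witt_mul_mem (O : ℕ → AddSubgroup K) (h1 : (1 : K) ∈ O 0)
    (hmul : ∀ m n a b, a ∈ O m → b ∈ O n → a * b ∈ O (m + n)) {a x : WittVector p K}
    (ha : ∀ i, a.coeff i ∈ O 0) (hx : ∀ i, x.coeff i ∈ O (p ^ i)) (i : ℕ) :
    (a * x).coeff i ∈ O (p ^ i) := by
  obtain ⟨z, hz⟩ := exists_lift_zero (h1 := h1) (hmul := hmul) ha
  obtain ⟨w, hw⟩ := exists_lift (h1 := h1) (hmul := hmul) hx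
  exact coeff_mem_of_lift (z * w) (by rw [map_mul, hz, hw, map_mul]; ring) i

theorem mk_map_truncate {n : ℕ} {R S : Type*} [CommRing R] [CommRing S] (f : R →+* S)
    (x : WittVector p R) :
    TruncatedWittVector.mk p (fun i => f ((WittVector.truncate n x).coeff i)) =
      WittVector.truncate n (WittVector.map f x) := by
  ext i
  rw [TruncatedWittVector.coeff_mk, WittVector.coeff_truncate, WittVector.coeff_truncate,
    WittVector.map_coeff]

/-- The ring homomorphism `Wₙ(R) → Wₙ(S)` induced by `f : R → S`: apply `f` to each component. -/
noncomputable def truncatedMap (p : ℕ) [Fact p.Prime] (n : ℕ) {R S : Type*} [CommRing R]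
    [CommRing S] (f : R →+* S) : TruncatedWittVector p n R →+* TruncatedWittVector p n S where
  toFun x := TruncatedWittVector.mk p fun i => f (x.coeff i)
  map_one' := by rw [← map_one (WittVector.truncate n), mk_map_truncate, map_one, map_one]
  map_zero' := by rw [← map_zero (WittVector.truncate n), mk_map_truncate, map_zero, map_zero]
  map_mul' x y := by
    obtain ⟨x, rfl⟩ := WittVector.truncate_surjective p n R x
    obtain ⟨y, rfl⟩ := WittVector.truncate_surjective p n R y
    rw [← map_mul, mk_map_truncate, mk_map_truncate, mk_map_truncate, map_mul, map_mul]
  map_add' x y := by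
    obtain ⟨x, rfl⟩ := WittVector.truncate_surjective p n R x
    obtain ⟨y, rfl⟩ := WittVector.truncate_surjective p n R y
    rw [← map_add, mk_map_truncate, mk_map_truncate, mk_map_truncate, map_add, map_add]

end Witt

/-- A domain `A` is essentially smooth over the field `k` if it is a localisation of a smooth
`k`-algebra. -/
def IsEssentiallySmooth (k : Type v) (A : Type u) [Field k] [CommRing A] [Algebra k A] : Prop :=
  ∃ (B : Type u) (_ : CommRing B) (_ : Algebra k B) (_ : Algebra B A) (M : Submonoid B),
    IsScalarTower k B A ∧ Algebra.Smooth k B ∧ IsLocalization M A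

theorem IsEssentiallySmooth.isNoetherianRing {k : Type v} {A : Type u} [Field k] [CommRing A]
    [Algebra k A] (h : IsEssentiallySmooth k A) : IsNoetherianRing A := by
  obtain ⟨B, _, _, _, M, _, _, _⟩ := h
  have := Algebra.FiniteType.isNoetherianRing k B
  exact IsLocalization.isNoetherianRing M A this

theorem IsEssentiallySmooth.isIntegrallyClosed {k : Type v} {A : Type u} [Field k] [CommRing A]
    [IsDomain A] [Algebra k A] (h : IsEssentiallySmooth k A) : IsIntegrallyClosed A := by
  obtain ⟨B, _, _, _, M, _, _, _⟩ := h
  exact isIntegrallyClosed_of_isLocalization_smooth k A B M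

section Divisors

open TopologicalSpace

variable (A : Type u) [CommRing A]

/-- The prime divisors of `X = Spec A`, given by their generic points: the points of codimension
one. -/
def PrimeDivisor : Type u := {y : PrimeSpectrum A // y.asIdeal.height = 1}

/-- The group of `ℝ`-divisors on `X = Spec A`. -/
abbrev RDivisor : Type u := PrimeDivisor A →₀ ℝ

variable {A}

/-- The fractional part `{D} = D - ⌊D⌋` of an `ℝ`-divisor. -/
noncomputable def fracPart (D : RDivisor A) : RDivisor A :=
  D.mapRange Int.fract Int.fract_zero

/-- A set `S` of prime divisors on `X = Spec A` is simple normal crossing if at every point `x`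
there is a regular system of parameters `t₁, …, t_d` of the local ring `𝒪_{X,x}` (so `d` is its
dimension, and `𝒪_{X,x}` is regular) such that each member of `S` through `x` is defined at `x` by
one of the `tᵢ`. -/
def IsSimpleNormalCrossing (S : Set (PrimeDivisor A)) : Prop :=
  ∀ x : PrimeSpectrum A, ∃ (d : ℕ) (t : Fin d → Localization.AtPrime x.asIdeal),
    ringKrullDim (Localization.AtPrime x.asIdeal) = d ∧
    Ideal.span (Set.range t) = IsLocalRing.maximalIdeal (Localization.AtPrime x.asIdeal) ∧
    ∀ y ∈ S, y.1.asIdeal ≤ x.asIdeal →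
      ∃ i, y.1.asIdeal.map (algebraMap A (Localization.AtPrime x.asIdeal)) = Ideal.span {t i}

instance (y : PrimeDivisor A) : Ring.KrullDimLE 1 (Localization.AtPrime y.1.asIdeal) := by
  rw [Ring.krullDimLE_iff,
    IsLocalization.AtPrime.ringKrullDim_eq_height y.1.asIdeal, y.2]
  rfl

variable [IsDomain A] [IsNoetherianRing A]

/-- The order `ord_Y(φ)` of a rational function along a prime divisor, i.e. the coefficient of
`Y` in `div(φ)`; the value is meaningful for `φ ≠ 0`. -/
noncomputable def ord (y : PrimeDivisor A) (φ : FractionRing A) : ℤ :=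
  (Ring.ordFrac (Localization.AtPrime y.1.asIdeal) φ).log

theorem ord_mul (y : PrimeDivisor A) {φ ψ : FractionRing A} (hφ : φ ≠ 0) (hψ : ψ ≠ 0) :
    ord y (φ * ψ) = ord y φ + ord y ψ := by
  rw [ord, map_mul, WithZero.log_mul (by simpa using hφ) (by simpa using hψ)]
  rfl

theorem ord_neg (y : PrimeDivisor A) (φ : FractionRing A) : ord y (-φ) = ord y φ := by
  by_cases hφ : φ = 0
  · simp [hφ]
  have h : ord y (-1 : FractionRing A) + ord y (-1 : FractionRing A) = 0 := by
    rw [← ord_mul y (by simp) (by simp)]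
    simp [ord]
  rw [← neg_one_mul, ord_mul y (by simp) hφ]
  omega

theorem ord_algebraMap_nonneg (y : PrimeDivisor A) (a : Localization.AtPrime y.1.asIdeal) :
    0 ≤ ord y (algebraMap _ (FractionRing A) a) := by
  by_cases ha : a = 0
  · simp [ha, ord]
  have h := Ring.ordFrac_ge_one_of_ne_zero (K := FractionRing A) ha
  rw [ord, ← WithZero.log_one]
  exact (WithZero.log_le_log one_ne_zero (zero_lt_one.trans_le h).ne').mpr h

variable [IsIntegrallyClosed A]

instance (y : PrimeDivisor A) : IsDiscreteValuationRing (Localization.AtPrime y.1.asIdeal) := by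
  have hdim := IsLocalization.AtPrime.ringKrullDim_eq_height y.1.asIdeal
    (Localization.AtPrime y.1.asIdeal)
  rw [y.2] at hdim
  have hf : ¬ IsField (Localization.AtPrime y.1.asIdeal) := fun h => by
    rw [ringKrullDim_eq_zero_of_isField h] at hdim
    exact absurd hdim (by decide)
  have : IsIntegrallyClosed (Localization.AtPrime y.1.asIdeal) :=
    isIntegrallyClosed_of_isLocalization _ y.1.asIdeal.primeCompl
      y.1.asIdeal.primeCompl_le_nonZeroDivisors
  refine ((IsDiscreteValuationRing.TFAE (Localization.AtPrime y.1.asIdeal) hf).out 0 3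
    (a := IsDiscreteValuationRing (Localization.AtPrime y.1.asIdeal))
    (b := IsIntegrallyClosed (Localization.AtPrime y.1.asIdeal) ∧
      ∃! P : Ideal (Localization.AtPrime y.1.asIdeal), P ≠ ⊥ ∧ P.IsPrime)).mpr
    ⟨this, IsLocalRing.maximalIdeal _, ⟨?_, inferInstance⟩, fun P hP => ?_⟩
  · exact fun h => hf (IsLocalRing.isField_iff_maximalIdeal_eq.mpr h)
  · have := hP.2
    exact IsLocalRing.eq_maximalIdeal
      (Ring.krullDimLE_one_iff_of_isPrime_bot.mp inferInstance P hP.1 this)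

theorem le_ord_add (y : PrimeDivisor A) {φ ψ : FractionRing A} (hφ : φ ≠ 0) (hψ : ψ ≠ 0)
    (h : φ + ψ ≠ 0) : min (ord y φ) (ord y ψ) ≤ ord y (φ + ψ) := by
  have := Ring.ordFrac_add (R := Localization.AtPrime y.1.asIdeal) φ ψ h
  have h1 : Ring.ordFrac (Localization.AtPrime y.1.asIdeal) φ ≠ 0 := by simpa using hφ
  have h2 : Ring.ordFrac (Localization.AtPrime y.1.asIdeal) ψ ≠ 0 := by simpa using hψ
  have h3 : Ring.ordFrac (Localization.AtPrime y.1.asIdeal) (φ + ψ) ≠ 0 := by simpa using h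
  rw [min_le_iff] at this ⊢
  exact this.imp (WithZero.log_le_log h1 h3).mpr (WithZero.log_le_log h2 h3).mpr

/-- `Γ(U, 𝒪_X(D)) = {φ ∈ K(X) | (div(φ) + D)|_U ≥ 0}` (with `0` included), for `X = Spec A`. -/
noncomputable def divisorialSections (D : RDivisor A) (U : Opens (PrimeSpectrum A)) :
    AddSubgroup (FractionRing A) where
  carrier := {φ | φ ≠ 0 → ∀ y : PrimeDivisor A, y.1 ∈ U → 0 ≤ (ord y φ : ℝ) + D y}
  zero_mem' h := absurd rfl h
  neg_mem' {φ} hφ h y hy := by rw [ord_neg]; exact hφ (neg_ne_zero.mp h) y hy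
  add_mem' {φ ψ} hφ hψ h y hy := by
    by_cases h1 : φ = 0
    · subst h1; rw [zero_add] at h ⊢; exact hψ h y hy
    by_cases h2 : ψ = 0
    · subst h2; rw [add_zero] at h ⊢; exact hφ h y hy
    have h3 := hφ h1 y hy
    have h4 := hψ h2 y hy
    rcases min_le_iff.mp (le_ord_add y h1 h2 h) with h5 | h5
    · have : (ord y φ : ℝ) ≤ ord y (φ + ψ) := by exact_mod_cast h5
      linarith
    · have : (ord y ψ : ℝ) ≤ ord y (φ + ψ) := by exact_mod_cast h5
      linarith

theorem divisorialSections_mono (D : RDivisor A) {U V : Opens (PrimeSpectrum A)} (h : U ≤ V) :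
    divisorialSections D V ≤ divisorialSections D U :=
  fun _ hφ h0 y hy => hφ h0 y (h hy)

theorem one_mem_divisorialSections (U : Opens (PrimeSpectrum A)) :
    (1 : FractionRing A) ∈ divisorialSections 0 U := fun _ y _ => by simp [ord]

theorem mul_mem_divisorialSections {D E : RDivisor A} {U : Opens (PrimeSpectrum A)}
    {φ ψ : FractionRing A} (hφ : φ ∈ divisorialSections D U) (hψ : ψ ∈ divisorialSections E U) :
    φ * ψ ∈ divisorialSections (D + E) U := fun h y hy => by
  have h1 := left_ne_zero_of_mul h
  have h2 := right_ne_zero_of_mul h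
  have h3 := hφ h1 y hy
  have h4 := hψ h2 y hy
  rw [ord_mul y h1 h2, Finsupp.add_apply]
  push_cast
  linarith

theorem exists_mem_divisorialSections_zero (x : PrimeSpectrum A)
    (a : Localization.AtPrime x.asIdeal) : ∃ U : Opens (PrimeSpectrum A), x ∈ U ∧
      algebraMap _ (FractionRing A) a ∈ divisorialSections 0 U := by
  obtain ⟨b, s, rfl⟩ := IsLocalization.exists_mk'_eq x.asIdeal.primeCompl a
  refine ⟨PrimeSpectrum.basicOpen s.1, s.2, fun _ y hy => ?_⟩
  have key : algebraMap _ (FractionRing A) (IsLocalization.mk' (Localization.AtPrime x.asIdeal) b s)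
      = algebraMap _ (FractionRing A)
        (IsLocalization.mk' (Localization.AtPrime y.1.asIdeal) b
          (⟨s.1, hy⟩ : y.1.asIdeal.primeCompl)) := by
    have hs : algebraMap A (FractionRing A) s.1 ≠ 0 := fun h =>
      nonZeroDivisors.ne_zero (x.asIdeal.primeCompl_le_nonZeroDivisors s.2)
        (IsFractionRing.injective A (FractionRing A) (h.trans (map_zero _).symm))
    apply mul_right_cancel₀ hs
    conv_lhs => rw [IsScalarTower.algebraMap_apply A (Localization.AtPrime x.asIdeal)
      (FractionRing A) s.1, ← map_mul, IsLocalization.mk'_spec, ← IsScalarTower.algebraMap_apply]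
    conv_rhs => rw [IsScalarTower.algebraMap_apply A (Localization.AtPrime y.1.asIdeal)
      (FractionRing A) s.1, ← map_mul]
    have := IsLocalization.mk'_spec (Localization.AtPrime y.1.asIdeal) b
      (⟨s.1, hy⟩ : y.1.asIdeal.primeCompl)
    rw [this, ← IsScalarTower.algebraMap_apply]
  rw [key, Finsupp.zero_apply, add_zero]
  exact_mod_cast ord_algebraMap_nonneg y _

variable (p : ℕ) [Fact p.Prime] (n : ℕ)

/-- `Γ(U, WₙO_X(D)) ⊆ Wₙ(K(X))`: the Witt vectors `(φ₀, …, φₙ₋₁)` of rational functions with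
`(div(φᵢ) + pⁱD)|_U ≥ 0` for all `i`. -/
noncomputable def wittDivisorialSections (D : RDivisor A) (U : Opens (PrimeSpectrum A)) :
    AddSubgroup (TruncatedWittVector p n (FractionRing A)) where
  carrier := {φ | ∀ i : Fin n, φ.coeff i ∈ divisorialSections ((p ^ (i : ℕ) : ℝ) • D) U}
  zero_mem' i := by rw [TruncatedWittVector.coeff_zero]; exact zero_mem _
  add_mem' {φ ψ} hφ hψ i := by
    have := witt_add_mem (fun m => divisorialSections ((m : ℝ) • D) U)
      (by simpa using one_mem_divisorialSections U)
      (fun a b _ _ h1 h2 => by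
        rw [Nat.cast_add, add_smul]; exact mul_mem_divisorialSections h1 h2)
      (coeff_out_mem (O := fun i => divisorialSections (((p ^ i : ℕ) : ℝ) • D) U)
        (by simpa using hφ))
      (coeff_out_mem (O := fun i => divisorialSections (((p ^ i : ℕ) : ℝ) • D) U)
        (by simpa using hψ)) i
    simpa [← WittVector.coeff_truncateFun] using this
  neg_mem' {φ} hφ i := by
    have := witt_neg_mem (fun m => divisorialSections ((m : ℝ) • D) U)
      (by simpa using one_mem_divisorialSections U)
      (fun a b _ _ h1 h2 => by
        rw [Nat.cast_add, add_smul]; exact mul_mem_divisorialSections h1 h2)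
      (coeff_out_mem (O := fun i => divisorialSections (((p ^ i : ℕ) : ℝ) • D) U)
        (by simpa using hφ)) i
    simpa [← WittVector.coeff_truncateFun, WittVector.truncateFun_neg] using this

theorem mul_mem_wittDivisorialSections {D : RDivisor A} {U : Opens (PrimeSpectrum A)}
    {a φ : TruncatedWittVector p n (FractionRing A)}
    (ha : ∀ i, a.coeff i ∈ divisorialSections 0 U) (hφ : φ ∈ wittDivisorialSections p n D U) :
    a * φ ∈ wittDivisorialSections p n D U := fun i => by
  have := witt_mul_mem (fun m => divisorialSections ((m : ℝ) • D) U)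
    (by simpa using one_mem_divisorialSections U)
    (fun a b _ _ h1 h2 => by
      rw [Nat.cast_add, add_smul]; exact mul_mem_divisorialSections h1 h2)
    (coeff_out_mem (x := a) (O := fun _ => divisorialSections (((0 : ℕ) : ℝ) • D) U)
      (by simpa using ha))
    (coeff_out_mem (O := fun i => divisorialSections (((p ^ i : ℕ) : ℝ) • D) U)
      (fun j => by simpa using hφ j)) i
  simpa [← WittVector.coeff_truncateFun] using this

/-- `Wₙ(K(X))` as an algebra over `Wₙ(𝒪_{X,x})`, which is the stalk at `x` of the structure sheaf
`Wₙ𝒪_X` of the scheme `WₙX`. -/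
noncomputable instance (x : PrimeSpectrum A) :
    Algebra (TruncatedWittVector p n (Localization.AtPrime x.asIdeal))
      (TruncatedWittVector p n (FractionRing A)) :=
  (truncatedMap p n (algebraMap (Localization.AtPrime x.asIdeal) (FractionRing A))).toAlgebra

/-- The stalk `WₙO_X(D)_x` of the Witt divisorial sheaf, as a `Wₙ(𝒪_{X,x})`-module: the union in
`Wₙ(K(X))` of the `Γ(U, WₙO_X(D))` over all open neighbourhoods `U` of `x`. -/
noncomputable def wittDivisorialStalk (D : RDivisor A) (x : PrimeSpectrum A) :
    Submodule (TruncatedWittVector p n (Localization.AtPrime x.asIdeal))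
      (TruncatedWittVector p n (FractionRing A)) where
  carrier := {φ | ∃ U : Opens (PrimeSpectrum A), x ∈ U ∧ φ ∈ wittDivisorialSections p n D U}
  zero_mem' := ⟨⊤, trivial, zero_mem _⟩
  add_mem' := by
    rintro φ ψ ⟨U, hU, hφ⟩ ⟨V, hV, hψ⟩
    exact ⟨U ⊓ V, ⟨hU, hV⟩, add_mem
      (fun i => divisorialSections_mono _ inf_le_left (hφ i))
      (fun i => divisorialSections_mono _ inf_le_right (hψ i))⟩
  smul_mem' := by
    rintro a φ ⟨U, hU, hφ⟩
    choose V hxV hV using fun i => exists_mem_divisorialSections_zero x (a.coeff i)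
    refine ⟨U ⊓ ⨅ i, V i, ⟨hU, ?_⟩, ?_⟩
    · rw [Opens.coe_iInf]
      exact Set.mem_iInter.mpr hxV
    · rw [Algebra.smul_def]
      refine mul_mem_wittDivisorialSections p n (fun i => ?_)
        (fun i => divisorialSections_mono _ inf_le_left (hφ i))
      exact divisorialSections_mono _ (inf_le_right.trans (iInf_le _ i)) (hV i)

end Divisors

section CohenMacaulay

/-- The depth of a module over a local ring: the supremum of the lengths of the `M`-regular
sequences in the maximal ideal. -/
noncomputable def depth (R M : Type*) [CommRing R] [IsLocalRing R] [AddCommGroup M]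
    [Module R M] : ℕ∞ :=
  sSup {l | ∃ rs : List R, (∀ r ∈ rs, r ∈ IsLocalRing.maximalIdeal R) ∧
    RingTheory.Sequence.IsRegular M rs ∧ l = rs.length}

/-- `R` is a Noetherian local ring and `M` is a Cohen–Macaulay `R`-module: `M` is finitely
generated, and it is zero or its depth equals its dimension. -/
def IsCohenMacaulay (R M : Type*) [CommRing R] [AddCommGroup M] [Module R M] : Prop :=
  ∃ _ : IsLocalRing R, IsNoetherianRing R ∧ Module.Finite R M ∧
    (Nontrivial M → (depth R M : WithBot ℕ∞) = Module.supportDim R M)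

end CohenMacaulay

end WittDivisorial

open WittDivisorial

/-! Fix `x` and put `R = 𝒪_{X,x}`. The simple normal crossing condition provides a regular system of
parameters `t₁, …, t_d` at every point, so `R` is a regular local ring of dimension `d`. By
Auslander–Buchsbaum `R` is factorial (`uniqueFactorizationMonoid_of_isRegularRing`), so each `⌊pⁱD⌋`
is principal near `x` and the stalk of `𝒪_X(pⁱD)` is `gᵢR` (`exists_generator_divisorialSections`).
The stalk `N` of the Witt divisorial sheaf is therefore the set of Witt vectors whose `i`-th
component lies in `gᵢR`.

Filter `N` by the vanishing of the first `j` components. On such vectors the `j`-th component is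
additive, and `a ∈ Wₙ(R)` multiplies it by `a₀ ^ p ^ j`. Dividing by `g_j` identifies the graded
piece with the Frobenius twist `F^j_* R` (`exists_coeffFiltration_exact`). Frobenius is finite
because `k` is perfect, so the twist is a noetherian module. The Teichmüller lifts `[tᵢ]` act on it
as `tᵢ ^ p ^ j`, which is again a weakly regular sequence. Both properties pass to extensions, hence
to `N` (`isNoetherian_and_isWeaklyRegular_of_coeff`).

Finally `Wₙ(R) → R` has nilpotent kernel, so `Wₙ(R)` is local of dimension `d`. For `N ≠ 0` this
gives `d ≤ depth N ≤ dim N ≤ d`.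

Factoriality is proved without homological dimension: finite modules over `R` have free `d`-th
syzygies, Nagata's lemma reduces a height one prime to `R[1/t]`, and there it becomes invertible and
stably free, hence free. -/

namespace WittDivisorial

/-! ### Regular local rings: quotients by a parameter, and integrality -/

section RegularLocalRing

open IsLocalRing

variable {R : Type*} [CommRing R]

theorem ringKrullDim_quotient_span_singleton_ge [IsLocalRing R] [IsNoetherianRing R] {x : R}
    (hx : x ∈ maximalIdeal R) : ringKrullDim R ≤ ringKrullDim (R ⧸ Ideal.span {x}) + 1 := by
  refine (ringKrullDim_le_ringKrullDim_quotient_add_spanFinrank (Ideal.span {x}) ?_).trans ?_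
  · rwa [ringJacobson_eq_maximalIdeal, Ideal.span_singleton_le_iff_mem]
  gcongr
  have := Submodule.spanFinrank_span_le_ncard_of_finite (R := R) (Set.finite_singleton x)
  rw [Set.ncard_singleton] at this
  exact_mod_cast this

theorem map_maximalIdeal_quotient [IsLocalRing R] {I : Ideal R} [IsLocalRing (R ⧸ I)] :
    (maximalIdeal R).map (Ideal.Quotient.mk I) = maximalIdeal (R ⧸ I) := by
  have hI : I ≤ maximalIdeal R := le_maximalIdeal (Ideal.Quotient.nontrivial_iff.mp inferInstance)
  refine eq_maximalIdeal ((Ideal.map_eq_top_or_isMaximal_of_surjective _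
    Ideal.Quotient.mk_surjective (maximalIdeal.isMaximal R)).resolve_left fun h => ?_)
  have h2 := Ideal.comap_map_of_surjective _ (Ideal.Quotient.mk_surjective (I := I)) (maximalIdeal R)
  rw [h, Ideal.comap_top, ← RingHom.ker_eq_comap_bot, Ideal.mk_ker, sup_eq_left.mpr hI] at h2
  exact (maximalIdeal.isMaximal R).ne_top h2.symm

/-- Exchange argument: when `x` is written in a minimal generating set of the maximal ideal, some
coefficient is a unit because `x ∉ 𝔪²`, and that generator can be traded for `x`. -/
theorem exists_finset_span_insert_eq_maximalIdeal [IsRegularLocalRing R] {x : R}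
    (hx : x ∈ maximalIdeal R) (hx2 : x ∉ maximalIdeal R ^ 2) :
    ∃ s : Finset R, Ideal.span (insert x s) = maximalIdeal R ∧
      ((s.card : ℕ) : WithBot ℕ∞) + 1 = ringKrullDim R := by
  classical
  obtain ⟨s, hs, hspan⟩ := Submodule.FG.exists_span_finset_card_eq_spanFinrank
    (maximalIdeal R).fg_of_isNoetherianRing
  have hspan : Ideal.span (s : Set R) = maximalIdeal R := hspan
  have hx' := hx
  rw [← hspan, Submodule.mem_span_finset] at hx'
  obtain ⟨a, -, ha⟩ := hx'
  have hsm : ∀ i ∈ s, i ∈ maximalIdeal R := fun i hi => by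
    rw [← hspan]; exact Ideal.subset_span hi
  obtain ⟨j, hj, haj⟩ : ∃ j ∈ s, IsUnit (a j) := by
    by_contra! h
    refine hx2 (ha ▸ sum_mem fun i hi => ?_)
    rw [pow_two]
    exact Ideal.mul_mem_mul (h i hi) (hsm i hi)
  refine ⟨s.erase j, le_antisymm ?_ ?_, ?_⟩
  · rw [Ideal.span_le, Set.insert_subset_iff]
    exact ⟨hx, fun i hi => hsm i (Finset.mem_of_mem_erase hi)⟩
  · rw [← hspan, Ideal.span_le]
    intro i hi
    by_cases hij : i = j
    · subst hij
      have h1 : a i * i ∈ Ideal.span (insert x ((s.erase i : Finset R) : Set R)) := by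
        rw [← Finset.add_sum_erase s _ hj] at ha
        rw [show a i * i = x - ∑ k ∈ s.erase i, a k * k by rw [← ha]; simp]
        refine sub_mem (Ideal.subset_span (Set.mem_insert _ _)) (sum_mem fun k hk => ?_)
        exact Ideal.mul_mem_left _ _ (Ideal.subset_span (Set.mem_insert_of_mem _ hk))
      exact (Ideal.unit_mul_mem_iff_mem _ haj).mp h1
    · exact Ideal.subset_span (Set.mem_insert_of_mem _ (Finset.mem_erase.mpr ⟨hij, hi⟩))
  · rw [← IsRegularLocalRing.spanFinrank_maximalIdeal, ← hs, ← Finset.card_erase_add_one hj]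
    push_cast; rfl

/-- The remaining `d - 1` generators generate the maximal ideal of the quotient, while the dimension
drops by at most one. Since the dimension never exceeds the number of generators, both equal `d -
1`. -/
theorem isRegularLocalRing_quotient [IsRegularLocalRing R] {x : R}
    (hx : x ∈ maximalIdeal R) (hx2 : x ∉ maximalIdeal R ^ 2) :
    IsRegularLocalRing (R ⧸ Ideal.span {x}) ∧
      ringKrullDim (R ⧸ Ideal.span {x}) + 1 = ringKrullDim R := by
  classical
  have hne : Ideal.span {x} ≠ ⊤ := ne_top_of_le_ne_top (maximalIdeal.isMaximal R).ne_top
    ((Ideal.span_singleton_le_iff_mem _).mpr hx)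
  have : Nontrivial (R ⧸ Ideal.span {x}) := Ideal.Quotient.nontrivial_iff.mpr hne
  have : IsLocalRing (R ⧸ Ideal.span {x}) :=
    IsLocalRing.of_surjective' (Ideal.Quotient.mk _) Ideal.Quotient.mk_surjective
  obtain ⟨s, hs, hd⟩ := exists_finset_span_insert_eq_maximalIdeal hx hx2
  have hle := ringKrullDim_quotient_span_singleton_ge hx
  have hgen : (maximalIdeal (R ⧸ Ideal.span {x})).spanFinrank ≤ s.card := by
    have h : Ideal.span ((s.image (Ideal.Quotient.mk (Ideal.span {x})) : Finset _) : Set _) =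
        maximalIdeal (R ⧸ Ideal.span {x}) := by
      rw [← map_maximalIdeal_quotient, ← hs, Ideal.map_span, Set.image_insert_eq,
        Ideal.Quotient.eq_zero_iff_mem.mpr (Ideal.mem_span_singleton_self x), Finset.coe_image]
      simp
    rw [← h]
    refine (Submodule.spanFinrank_span_le_ncard_of_finite (Finset.finite_toSet _)).trans ?_
    rw [Set.ncard_coe_finset]
    exact Finset.card_image_le
  have hge : ((s.card : ℕ) : WithBot ℕ∞) ≤ ringKrullDim (R ⧸ Ideal.span {x}) := by
    rw [← hd] at hle
    exact ENat.WithBot.add_le_add_one_right_iff.mp hle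
  have hreg : IsRegularLocalRing (R ⧸ Ideal.span {x}) :=
    IsRegularLocalRing.of_spanFinrank_maximalIdeal_le _ (le_trans (by exact_mod_cast hgen) hge)
  refine ⟨hreg, le_antisymm ?_ hle⟩
  rw [← hd, ← IsRegularLocalRing.spanFinrank_maximalIdeal]
  gcongr

theorem exists_nat_ringKrullDim_eq (R : Type*) [CommRing R] [IsLocalRing R] [IsNoetherianRing R] :
    ∃ d : ℕ, ringKrullDim R = d := by
  obtain ⟨d, hd⟩ := WithBot.ne_bot_iff_exists.mp (ringKrullDim_ne_bot (R := R))
  have h : ringKrullDim R ≠ ⊤ := ringKrullDim_ne_top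
  rw [← hd] at h ⊢
  obtain ⟨m, rfl⟩ := ENat.ne_top_iff_exists.mp (fun h' => h (h' ▸ rfl) : d ≠ ⊤)
  exact ⟨m, rfl⟩

theorem isField_of_ringKrullDim_eq_zero [IsRegularLocalRing R] (h : ringKrullDim R = 0) :
    IsField R := by
  rw [isField_iff_maximalIdeal_eq]
  have h1 := IsRegularLocalRing.spanFinrank_maximalIdeal (R := R)
  rw [h] at h1
  exact (Submodule.spanFinrank_eq_zero_iff_eq_bot (maximalIdeal R).fg_of_isNoetherianRing).mp
    (by exact_mod_cast h1)

theorem maximalIdeal_not_le_sq [IsNoetherianRing R] [IsLocalRing R]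
    (h : maximalIdeal R ≠ ⊥) : ¬ maximalIdeal R ≤ maximalIdeal R ^ 2 := fun hle => by
  refine h (Submodule.eq_bot_of_le_smul_of_le_jacobson_bot (maximalIdeal R) (maximalIdeal R)
    (maximalIdeal R).fg_of_isNoetherianRing (by simpa [pow_two] using hle) ?_)
  rw [jacobson_eq_maximalIdeal _ bot_ne_top]

/-- Induction on the dimension: for `x` outside `𝔪²` and all minimal primes, `R/(x)` is a domain, so
`(x)` is prime and contains a minimal prime, which Nakayama shows to be zero. -/
theorem isDomain_of_isRegularLocalRing_aux (d : ℕ) (R : Type u) [CommRing R]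
    [IsRegularLocalRing R] (hd : ringKrullDim R = d) : IsDomain R := by
  induction d generalizing R with
  | zero => exact (isField_of_ringKrullDim_eq_zero (by exact_mod_cast hd)).isDomain
  | succ d ih =>
    have hm : ∀ P ∈ minimalPrimes R, ¬ maximalIdeal R ≤ P := fun P hP hle => by
      have h0 : (maximalIdeal R).height = 0 := by
        have := hP.1.1
        rw [← (maximalIdeal.isMaximal R).eq_of_le hP.1.1.ne_top hle] at hP
        exact Ideal.height_eq_zero_iff.mpr hP
      rw [← IsLocalRing.maximalIdeal_height_eq_ringKrullDim, h0] at hd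
      exact absurd hd (by norm_cast)
    have hbot : maximalIdeal R ≠ ⊥ := fun h => by
      obtain ⟨P, hP⟩ := Ideal.exists_minimalPrimes_le (I := (⊥ : Ideal R)) (J := maximalIdeal R) bot_le
      exact hm P hP.1 (h ▸ bot_le)
    obtain ⟨x, hx, hxs⟩ : ∃ x ∈ maximalIdeal R, x ∉ maximalIdeal R ^ 2 ∧
        ∀ P ∈ minimalPrimes R, x ∉ P := by
      by_contra! h
      -- Prime avoidance tolerates two ideals that are not prime; `𝔪²` fills both slots.
      have := (Ideal.subset_union_prime_finite (I := maximalIdeal R)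
        (s := insert (maximalIdeal R ^ 2) (minimalPrimes R))
        ((minimalPrimes.finite_of_isNoetherianRing R).insert _) (f := id) (maximalIdeal R ^ 2)
        (maximalIdeal R ^ 2) (fun P hP h1 _ => (hP.resolve_left h1).1.1)).mp (fun y hy => by
          by_cases h2 : y ∈ maximalIdeal R ^ 2
          · exact Set.mem_biUnion (Set.mem_insert _ _) h2
          · obtain ⟨P, hP, hyP⟩ := h y hy h2
            exact Set.mem_biUnion (Set.mem_insert_of_mem _ hP) hyP)
      obtain ⟨P, rfl | hP, hle⟩ := this
      · exact maximalIdeal_not_le_sq hbot hle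
      · exact hm P hP hle
    obtain ⟨hreg, hdim⟩ := isRegularLocalRing_quotient hx hxs.1
    have hdom := ih (R ⧸ Ideal.span {x}) (by
      rw [hd] at hdim
      push_cast at hdim
      exact le_antisymm (ENat.WithBot.add_le_add_one_right_iff.mp hdim.le)
        (ENat.WithBot.add_le_add_one_right_iff.mp hdim.ge))
    have hprime : (Ideal.span {x}).IsPrime := (Ideal.Quotient.isDomain_iff_prime _).mp hdom
    obtain ⟨P, hP, hPx⟩ := Ideal.exists_minimalPrimes_le (I := (⊥ : Ideal R))
      (J := Ideal.span {x}) bot_le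
    -- Each element of `P` is some `zx`, and `x ∉ P` forces `z ∈ P`; hence `P ⊆ 𝔪P`.
    have hPbot : P = ⊥ := by
      refine Submodule.eq_bot_of_le_smul_of_le_jacobson_bot (maximalIdeal R) P
        P.fg_of_isNoetherianRing (fun y hy => ?_) (jacobson_eq_maximalIdeal _ bot_ne_top).ge
      obtain ⟨z, rfl⟩ := Ideal.mem_span_singleton'.mp (hPx hy)
      have hz := (hP.1.1.mem_or_mem hy).resolve_right (hxs.2 P hP)
      rw [mul_comm]
      exact Submodule.smul_mem_smul hx hz
    have : (⊥ : Ideal R).IsPrime := hPbot ▸ hP.1.1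
    exact IsDomain.of_bot_isPrime R

theorem isDomain_of_isRegularLocalRing (R : Type u) [CommRing R] [IsRegularLocalRing R] :
    IsDomain R := by
  obtain ⟨d, hd⟩ := exists_nat_ringKrullDim_eq R
  exact isDomain_of_isRegularLocalRing_aux d R hd

end RegularLocalRing


/-! ### Weakly regular sequences: extensions, powers, systems of parameters -/

section WeaklyRegular

open IsLocalRing RingTheory.Sequence
open scoped Pointwise

/-- Regularity of `r` on `M₃` keeps the sequence exact on the left after reduction modulo `r`, so
the induction can continue with the quotients. -/
theorem isWeaklyRegular_of_exact {R : Type*} [CommRing R] (rs : List R) {M₁ M₂ M₃ : Type v}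
    [AddCommGroup M₁] [AddCommGroup M₂] [AddCommGroup M₃] [Module R M₁] [Module R M₂] [Module R M₃]
    (f : M₁ →ₗ[R] M₂) (g : M₂ →ₗ[R] M₃) (hf : Function.Injective f) (hfg : Function.Exact f g)
    (hg : Function.Surjective g) (h₁ : IsWeaklyRegular M₁ rs) (h₃ : IsWeaklyRegular M₃ rs) :
    IsWeaklyRegular M₂ rs := by
  induction rs generalizing M₁ M₂ M₃ with
  | nil => exact .nil R M₂
  | cons r rs ih =>
    rw [isWeaklyRegular_cons_iff] at h₁ h₃ ⊢
    refine ⟨isSMulRegular_of_range_eq_ker hf (LinearMap.exact_iff.mp hfg).symm h₁.1 h₃.1, ?_⟩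
    -- Injectivity is phrased as exactness at `M₁`, so that the four-term exact sequence lemma
    -- applies.
    have h0 : Function.Exact (0 : PUnit.{v + 1} →ₗ[R] M₁) f :=
      LinearMap.exact_zero_iff_injective _ f |>.mpr hf
    refine ih (QuotSMulTop.map r f) (QuotSMulTop.map r g) ?_ (QuotSMulTop.map_exact r hfg hg)
      (QuotSMulTop.map_surjective r hg) h₁.2 h₃.2
    have := QuotSMulTop.map_first_exact_on_four_term_exact_of_isSMulRegular_last h0 hfg h₃.1
    rw [map_zero] at this
    exact (LinearMap.exact_zero_iff_injective _ _).mp this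

theorem isWeaklyRegular_of_subsingleton {R : Type*} [CommRing R] (rs : List R) (M : Type v)
    [AddCommGroup M] [Module R M] [Subsingleton M] : IsWeaklyRegular M rs := by
  induction rs generalizing M with
  | nil => exact .nil R M
  | cons r rs ih => exact .cons (fun _ _ _ => Subsingleton.elim _ _) (ih _)

/-- Multiplication by `r` makes `M/r^(N+1)` an extension of `M/r` by `M/r^N`. The case `N = 0` is
the zero module, which weak regularity permits. -/
theorem isWeaklyRegular_quotSMulTop_pow {R : Type*} [CommRing R] (N : ℕ) (r : R) (rs : List R)
    {M : Type v} [AddCommGroup M] [Module R M] (hr : IsSMulRegular M r)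
    (h : IsWeaklyRegular (QuotSMulTop r M) rs) : IsWeaklyRegular (QuotSMulTop (r ^ N) M) rs := by
  induction N with
  | zero =>
    have : Subsingleton (QuotSMulTop (r ^ 0) M) := by
      rw [Submodule.Quotient.subsingleton_iff]
      simp
    exact isWeaklyRegular_of_subsingleton _ _
  | succ N ih =>
    refine isWeaklyRegular_of_exact rs
      (Submodule.mapQ (r ^ N • ⊤ : Submodule R M) (r ^ (N + 1) • ⊤) (LinearMap.lsmul R M r) ?_)
      (Submodule.factor (p := (r ^ (N + 1) • ⊤ : Submodule R M)) (p' := r • ⊤) ?_) ?_ ?_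
      (Submodule.factor_surjective _) ih h
    · intro x hx
      obtain ⟨y, -, rfl⟩ := (Submodule.mem_smul_pointwise_iff_exists _ _ _).mp hx
      exact (Submodule.mem_smul_pointwise_iff_exists _ _ _).mpr ⟨y, Submodule.mem_top, by
        rw [LinearMap.lsmul_apply, pow_succ', mul_smul]⟩
    · intro x hx
      obtain ⟨y, -, rfl⟩ := (Submodule.mem_smul_pointwise_iff_exists _ _ _).mp hx
      exact (Submodule.mem_smul_pointwise_iff_exists _ _ _).mpr ⟨r ^ N • y, Submodule.mem_top, by
        rw [pow_succ', mul_smul]⟩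
    · rw [injective_iff_map_eq_zero]
      intro x hx
      obtain ⟨x, rfl⟩ := Submodule.Quotient.mk_surjective _ x
      rw [Submodule.mapQ_apply, Submodule.Quotient.mk_eq_zero] at hx
      obtain ⟨y, -, hy⟩ := (Submodule.mem_smul_pointwise_iff_exists _ _ _).mp hx
      rw [LinearMap.lsmul_apply, pow_succ', mul_smul] at hy
      rw [Submodule.Quotient.mk_eq_zero]
      exact (Submodule.mem_smul_pointwise_iff_exists _ _ _).mpr ⟨y, Submodule.mem_top, hr hy⟩
    · intro x
      obtain ⟨x, rfl⟩ := Submodule.Quotient.mk_surjective _ x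
      rw [← Submodule.mkQ_apply, Submodule.factor_mk, Submodule.mkQ_apply,
        Submodule.mkQ_apply, Submodule.Quotient.mk_eq_zero]
      constructor
      · intro hx
        obtain ⟨y, -, rfl⟩ := (Submodule.mem_smul_pointwise_iff_exists _ _ _).mp hx
        exact ⟨Submodule.Quotient.mk y, rfl⟩
      · rintro ⟨y, hy⟩
        obtain ⟨y, rfl⟩ := Submodule.Quotient.mk_surjective _ y
        rw [Submodule.mapQ_apply, eq_comm, Submodule.Quotient.eq] at hy
        obtain ⟨z, -, hz⟩ := (Submodule.mem_smul_pointwise_iff_exists _ _ _).mp hy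
        refine (Submodule.mem_smul_pointwise_iff_exists _ _ _).mpr ⟨y + r ^ N • z, Submodule.mem_top, ?_⟩
        rw [smul_add, ← mul_smul, ← pow_succ', hz, LinearMap.lsmul_apply]
        abel

theorem isWeaklyRegular_map_pow {R : Type*} [CommRing R] (N : ℕ) (rs : List R) {M : Type v}
    [AddCommGroup M] [Module R M] (h : IsWeaklyRegular M rs) :
    IsWeaklyRegular M (rs.map (· ^ N)) := by
  induction rs generalizing M with
  | nil => exact .nil R M
  | cons r rs ih =>
    rw [isWeaklyRegular_cons_iff] at h
    rw [List.map_cons, isWeaklyRegular_cons_iff]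
    exact ⟨h.1.pow N, ih (isWeaklyRegular_quotSMulTop_pow N r rs h.1 h.2)⟩

/-- Such a ring is regular, hence a domain, so the first parameter is a nonzerodivisor; the quotient
by it satisfies the same hypotheses in one dimension less. -/
theorem isWeaklyRegular_of_ofList_eq_maximalIdeal (R : Type u) [CommRing R]
    [IsNoetherianRing R] [IsLocalRing R] (rs : List R) (h : Ideal.ofList rs = maximalIdeal R)
    (hd : ringKrullDim R = rs.length) : IsWeaklyRegular R rs := by
  classical
  induction hn : rs.length generalizing R with
  | zero => rw [List.eq_nil_of_length_eq_zero hn]; exact .nil R R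
  | succ n ih =>
    obtain ⟨r, rs', rfl⟩ := List.exists_cons_of_length_eq_add_one hn
    have hspan (l : List R) : ((Ideal.ofList l).spanFinrank : WithBot ℕ∞) ≤ l.length := by
      rw [Ideal.ofList, show {r | r ∈ l} = (l.toFinset : Set R) by ext; simp]
      have h1 := Submodule.spanFinrank_span_le_ncard_of_finite (R := R) (Finset.finite_toSet l.toFinset)
      rw [Set.ncard_coe_finset] at h1
      exact_mod_cast h1.trans (List.toFinset_card_le l)
    have hreg : IsRegularLocalRing R :=
      .of_spanFinrank_maximalIdeal_le _ (by rw [← h, hd]; exact hspan _)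
    have := isDomain_of_isRegularLocalRing R
    have hr : r ∈ maximalIdeal R := by
      rw [← h, Ideal.ofList_cons]
      exact Ideal.mem_sup_left (Ideal.mem_span_singleton_self r)
    -- If `r` were zero, the other `n` elements would generate the maximal ideal of a ring of
    -- dimension `n + 1`.
    have hr0 : r ≠ 0 := by
      rintro rfl
      have h1 := ringKrullDim_le_spanFinrank_maximalIdeal R
      rw [hd, ← h, Ideal.ofList_cons, Ideal.span_singleton_zero, bot_sup_eq] at h1
      have h2 := h1.trans (hspan rs')
      rw [List.length_cons] at h2
      norm_cast at h2
      omega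
    have hreg0 : IsSMulRegular R r := IsSMulRegular.of_ne_zero hr0
    rw [isWeaklyRegular_cons_iff]
    refine ⟨hreg0, ?_⟩
    have : Nontrivial (R ⧸ Ideal.span {r}) := Ideal.Quotient.nontrivial_iff.mpr
      (ne_top_of_le_ne_top (maximalIdeal.isMaximal R).ne_top
        ((Ideal.span_singleton_le_iff_mem _).mpr hr))
    have : IsLocalRing (R ⧸ Ideal.span {r}) :=
      IsLocalRing.of_surjective' (Ideal.Quotient.mk _) Ideal.Quotient.mk_surjective
    have hdim := ringKrullDim_quotient_span_singleton_succ_eq_ringKrullDim hreg0 hr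
    have key := ih (R ⧸ Ideal.span {r}) (rs'.map (Ideal.Quotient.mk _)) (by
      rw [← Ideal.map_ofList, ← map_maximalIdeal_quotient, ← h, Ideal.ofList_cons, Ideal.map_sup,
        Ideal.map_quotient_self, bot_sup_eq]) (by
      rw [List.length_map]
      rw [hd, List.length_cons] at hdim
      push_cast at hdim
      exact le_antisymm (ENat.WithBot.add_le_add_one_right_iff.mp hdim.le)
        (ENat.WithBot.add_le_add_one_right_iff.mp hdim.ge)) (by simpa using hn)
    have key' : IsWeaklyRegular (R ⧸ Ideal.span {r}) rs' :=
      (isWeaklyRegular_map_algebraMap_iff (R ⧸ Ideal.span {r}) (R ⧸ Ideal.span {r}) rs').mp key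
    exact ((Submodule.quotEquivOfEq _ _ (by simp [← Submodule.ideal_span_singleton_smul])
      ).isWeaklyRegular_congr rs').mp key'
end WeaklyRegular


/-! ### Hilbert's syzygy theorem and stably free base change -/

section FreeResolution

open IsLocalRing
open scoped Pointwise TensorProduct

/-- Every resolution of `M` by finite free modules has a free `n`-th syzygy. -/
def SyzygyFree (R : Type u) [CommRing R] :
    ℕ → ∀ (M : Type u) [AddCommGroup M] [Module R M], Prop
  | 0, M, _, _ => Module.Free R M
  | n + 1, M, _, _ => ∀ (F : Type u) [AddCommGroup F] [Module R F] [Module.Free R F]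
      [Module.Finite R F] (f : F →ₗ[R] M), Function.Surjective f →
        SyzygyFree R n (LinearMap.ker f)

variable {R : Type u} [CommRing R]

theorem SyzygyFree.of_equiv {n : ℕ} {M N : Type u} [AddCommGroup M] [Module R M]
    [AddCommGroup N] [Module R N] (e : M ≃ₗ[R] N) (h : SyzygyFree R n M) : SyzygyFree R n N := by
  cases n with
  | zero =>
    have : Module.Free R M := h
    exact Module.Free.of_equiv e
  | succ n =>
    intro F _ _ _ _ f hf
    have := h F (e.symm.toLinearMap ∘ₗ f) (e.symm.surjective.comp hf)
    rwa [LinearMap.ker_comp_of_ker_eq_bot _ e.symm.ker] at this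

/-- Since `t` is regular on `M`, a presentation of `M` stays exact modulo `t`, so syzygies commute
with reduction. At the last stage, freeness modulo a regular element of the maximal ideal lifts. -/
theorem SyzygyFree.of_quotSMulTop [IsLocalRing R] [IsNoetherianRing R] {t : R}
    (ht : t ∈ maximalIdeal R) (htR : IsSMulRegular R t) (n : ℕ) (M : Type u) [AddCommGroup M]
    [Module R M] [Module.Finite R M] (htM : IsSMulRegular M t)
    (h : SyzygyFree (R ⧸ Ideal.span {t}) n (QuotSMulTop t M)) : SyzygyFree R n M := by
  induction n generalizing M with
  | zero =>
    have := Module.finitePresentation_of_finite R M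
    exact (Module.free_quotSMulTop_iff_free R M (by rwa [jacobson_eq_maximalIdeal _ bot_ne_top])
      htM).mp h
  | succ n ih =>
    intro F _ _ _ _ f hf
    have htF : IsSMulRegular F t := by
      intro x y hxy
      apply (Module.Free.chooseBasis R F).repr.injective
      ext i
      exact htR (by simpa using congrArg (fun z => (Module.Free.chooseBasis R F).repr z i) hxy)
    have hker : IsSMulRegular (LinearMap.ker f) t := htF.submodule (LinearMap.ker f) t
    refine ih _ hker ?_
    let g : QuotSMulTop t F →ₗ[R ⧸ Ideal.span {t}] QuotSMulTop t M :=
      LinearMap.extendScalarsOfSurjective Ideal.Quotient.mk_surjective (QuotSMulTop.map t f)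
    have hg : Function.Surjective g := QuotSMulTop.map_surjective t hf
    let i : QuotSMulTop t (LinearMap.ker f) →ₗ[R ⧸ Ideal.span {t}] QuotSMulTop t F :=
      LinearMap.extendScalarsOfSurjective Ideal.Quotient.mk_surjective
        (QuotSMulTop.map t (LinearMap.ker f).subtype)
    have hexact : Function.Exact i g := QuotSMulTop.map_exact t (LinearMap.exact_subtype_ker_map f) hf
    have hi : Function.Injective i := by
      have h0 : Function.Exact (0 : PUnit.{u + 1} →ₗ[R] LinearMap.ker f)
          (LinearMap.ker f).subtype :=
        LinearMap.exact_zero_iff_injective _ _ |>.mpr (LinearMap.ker f).injective_subtype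
      have := QuotSMulTop.map_first_exact_on_four_term_exact_of_isSMulRegular_last h0
        (LinearMap.exact_subtype_ker_map f) htM
      rw [map_zero] at this
      exact (LinearMap.exact_zero_iff_injective _ _).mp this
    have := Module.Finite.of_restrictScalars_finite R (R ⧸ Ideal.span {t}) (QuotSMulTop t F)
    refine SyzygyFree.of_equiv (LinearEquiv.ofInjective i hi ≪≫ₗ LinearEquiv.ofEq _ _
      (LinearMap.exact_iff.mp hexact).symm).symm (h _ g hg)

/-- A first syzygy is torsion-free, so any `t ∈ 𝔪 \ 𝔪²` is regular on it; induction then applies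
over the regular ring `R/(t)` of dimension `d`. -/
theorem syzygyFree_of_isRegularLocalRing (d : ℕ) (R : Type u) [CommRing R] [IsRegularLocalRing R]
    (hd : ringKrullDim R = d) (M : Type u) [AddCommGroup M] [Module R M] [Module.Finite R M] :
    SyzygyFree R d M := by
  induction d generalizing R M with
  | zero =>
    let _ : Field R := (isField_of_ringKrullDim_eq_zero (by exact_mod_cast hd)).toField
    exact Module.Free.of_divisionRing R M
  | succ d ih =>
    intro F _ _ _ _ f hf
    have hbot : maximalIdeal R ≠ ⊥ := fun h => by
      rw [ringKrullDim_eq_zero_of_isField (isField_iff_maximalIdeal_eq.mpr h)] at hd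
      exact absurd hd (by norm_cast)
    obtain ⟨t, ht, ht2⟩ := Set.not_subset.mp (maximalIdeal_not_le_sq hbot)
    have := isDomain_of_isRegularLocalRing R
    have ht0 : t ≠ 0 := fun h => ht2 (h ▸ zero_mem _)
    obtain ⟨hreg, hdim⟩ := isRegularLocalRing_quotient ht ht2
    have hker : Module.Finite R (LinearMap.ker f) := inferInstance
    have := Module.Finite.of_restrictScalars_finite R (R ⧸ Ideal.span {t})
      (QuotSMulTop t (LinearMap.ker f))
    refine SyzygyFree.of_quotSMulTop ht (.of_ne_zero ht0) d _ (.of_ne_zero ht0)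
      (ih (R ⧸ Ideal.span {t}) ?_ _)
    rw [hd] at hdim
    push_cast at hdim
    exact le_antisymm (ENat.WithBot.add_le_add_one_right_iff.mp hdim.le)
      (ENat.WithBot.add_le_add_one_right_iff.mp hdim.ge)

/-- Over `S` the presentation splits because `S ⊗ M` is projective, so the syzygy `S ⊗ ker f` is
again projective, and stably free by induction. If `(S ⊗ ker f) ⊕ G` is free, then adding it to `S ⊗
M` gives a base-changed free module plus `G`. -/
theorem SyzygyFree.isStablyFree_tensorProduct [IsNoetherianRing R] (S : Type u) [CommRing S] [Algebra R S]
    [Module.Flat R S] (n : ℕ) (M : Type u) [AddCommGroup M] [Module R M] [Module.Finite R M]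
    [Module.Projective S (S ⊗[R] M)] (h : SyzygyFree R n M) : Module.IsStablyFree S (S ⊗[R] M) := by
  induction n generalizing M with
  | zero =>
    have : Module.Free R M := h
    infer_instance
  | succ n ih =>
    obtain ⟨m, f, hf⟩ := Module.Finite.exists_fin' R M
    have hexact : Function.Exact ((LinearMap.ker f).subtype.baseChange S) (f.baseChange S) :=
      lTensor_exact S (LinearMap.exact_subtype_ker_map f) hf
    have hinj : Function.Injective ((LinearMap.ker f).subtype.baseChange S) :=
      Module.Flat.lTensor_preserves_injective_linearMap _ (LinearMap.ker f).injective_subtype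
    obtain ⟨l, hl⟩ := Module.projective_lifting_property (f.baseChange S) LinearMap.id
      (LinearMap.lTensor_surjective S hf)
    let e := (hexact.splitSurjectiveEquiv hinj ⟨l, hl⟩).1
    have : Module.Projective S (S ⊗[R] LinearMap.ker f) :=
      Module.Projective.of_split (e.symm.toLinearMap ∘ₗ LinearMap.inl S _ _)
        (LinearMap.fst S _ _ ∘ₗ e.toLinearMap) (by ext; simp)
    have := ih _ (h _ f hf)
    obtain ⟨G, _, _, _, _, _⟩ := Module.IsStablyFree.exist_free_prod S (S ⊗[R] LinearMap.ker f)
    have : Module.Free S ((S ⊗[R] M) × ((S ⊗[R] LinearMap.ker f) × G)) :=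
      Module.Free.of_equiv (((LinearEquiv.prodAssoc S _ _ _).symm ≪≫ₗ
        (LinearEquiv.prodComm S _ _ ≪≫ₗ e.symm).prodCongr (LinearEquiv.refl S G)).symm)
    exact .of_free_prod S _ ((S ⊗[R] LinearMap.ker f) × G)

end FreeResolution


/-! ### Factoriality of regular local rings (Auslander–Buchsbaum) -/

section Factoriality

open IsLocalRing
open scoped Pointwise TensorProduct

variable {R : Type u} [CommRing R]

theorem isRegularRing_localization [IsRegularRing R] (M : Submonoid R) :
    IsRegularRing (Localization M) := by
  have := IsLocalization.isNoetherianRing M (Localization M) inferInstance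
  rw [isRegularRing_iff]
  intro q _
  exact IsRegularLocalRing.of_ringEquiv
    (IsLocalization.localizationLocalizationAtPrimeIsoLocalization M q).toRingEquiv

/-- If the extension of `P` to `R_q` is principal, then `P` is principal up to an element
outside of `q`. -/
theorem exists_mul_mem_span_singleton_of_isPrincipal_map [IsNoetherianRing R] (P q : Ideal R)
    [q.IsPrime] (h : (P.map (algebraMap R (Localization.AtPrime q))).IsPrincipal) :
    ∃ a ∈ P, ∃ s ∉ q, ∀ z ∈ P, s * z ∈ Ideal.span {a} := by
  classical
  obtain ⟨g, hg⟩ := h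
  have hgP : g ∈ P.map (algebraMap R (Localization.AtPrime q)) := by
    rw [hg]; exact Submodule.mem_span_singleton_self g
  obtain ⟨⟨⟨a, ha⟩, u⟩, hau⟩ := (IsLocalization.mem_map_algebraMap_iff q.primeCompl _).mp hgP
  have key : ∀ z ∈ P, ∃ s ∉ q, s * z ∈ Ideal.span {a} := fun z hz => by
    have hz' := Ideal.mem_map_of_mem (algebraMap R (Localization.AtPrime q)) hz
    rw [hg] at hz'
    obtain ⟨r, hr⟩ := Submodule.mem_span_singleton.mp hz'
    obtain ⟨b, v, rfl⟩ := IsLocalization.exists_mk'_eq q.primeCompl r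
    -- Denominators are cleared in `z = (b/v)g` and `g = a/u`.
    have h1 : algebraMap R (Localization.AtPrime q) (u * v * z) = algebraMap R _ (b * a) := by
      rw [map_mul, map_mul, ← hr, map_mul, ← hau, smul_eq_mul]
      calc _ = (IsLocalization.mk' (Localization.AtPrime q) b v * algebraMap R _ (v : R)) *
            (g * algebraMap R _ (u : R)) := by ring
        _ = _ := by rw [IsLocalization.mk'_spec]
    obtain ⟨c, hc⟩ := (IsLocalization.eq_iff_exists q.primeCompl _).mp h1
    refine ⟨c * (u * v), (c * (u * v)).2, Ideal.mem_span_singleton'.mpr ⟨c * b, ?_⟩⟩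
    linear_combination -hc
  choose! s hs hsz using key
  obtain ⟨S, hS⟩ := P.fg_of_isNoetherianRing
  have hSP : ∀ z ∈ S, z ∈ P := fun z hz => hS ▸ Ideal.subset_span hz
  -- The product of the multipliers of finitely many generators serves all of `P` at once.
  refine ⟨a, ha, ∏ z ∈ S, s z, fun hmem => ?_, fun z hz => ?_⟩
  · obtain ⟨z, hz, hzq⟩ := (Ideal.IsPrime.prod_mem_iff).mp hmem
    exact hs z (hSP z hz) hzq
  · rw [← hS] at hz
    induction hz using Submodule.span_induction with
    | mem z hz =>
      rw [← Finset.prod_erase_mul _ _ hz, mul_assoc]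
      exact Ideal.mul_mem_left _ _ (hsz z (hSP z hz))
    | zero => simp
    | add x y _ _ hx hy => rw [mul_add]; exact add_mem hx hy
    | smul r x _ hx => rw [smul_eq_mul, mul_left_comm]; exact Ideal.mul_mem_left _ _ hx

/-- A nonzero ideal which is locally principal on the complement of `t = 0` becomes invertible
after inverting `t`. -/
theorem invertible_map_away [IsDomain R] {t : R} (ht : t ≠ 0) (P : Ideal R) (hP : P ≠ ⊥)
    (h : ∀ q : Ideal R, q.IsPrime → t ∉ q → ∃ a ∈ P, ∃ s ∉ q, ∀ z ∈ P, s * z ∈ Ideal.span {a}) :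
    Module.Invertible (Localization.Away t) (P.map (algebraMap R (Localization.Away t))) := by
  let S := Localization.Away t
  have hle : Submonoid.powers t ≤ nonZeroDivisors R :=
    powers_le_nonZeroDivisors_of_noZeroDivisors ht
  have hinj : Function.Injective (algebraMap R S) := IsLocalization.injective S hle
  have : IsDomain S := IsLocalization.isDomain_of_le_nonZeroDivisors _ hle
  let K := FractionRing S
  have hSK : Function.Injective (algebraMap S K) := IsFractionRing.injective S K
  let I : Submodule S K := 
    Submodule.map (Algebra.linearMap S K) (P.map (algebraMap R S))
  -- If `sP ⊆ (a)` with `a ∈ P` nonzero, then `s = a · (s/a)` with `s/a ∈ I⁻¹`.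
  have hmul : ∀ s ∈ Ideal.span {s : R | ∃ a ∈ P, ∀ z ∈ P, s * z ∈ Ideal.span {a}},
      algebraMap S K (algebraMap R S s) ∈ I * (1 / I) := fun s hs => by
    induction hs using Submodule.span_induction with
    | mem s hs =>
      obtain ⟨a, ha, hs⟩ := hs
      by_cases ha0 : a = 0
      · obtain ⟨z, hz, hz0⟩ := Submodule.exists_mem_ne_zero_of_ne_bot hP
        have := hs z hz
        rw [ha0, Ideal.span_singleton_zero, Ideal.mem_bot] at this
        rw [(mul_eq_zero.mp this).resolve_right hz0]
        simp
      have haK : algebraMap S K (algebraMap R S a) ≠ 0 := fun h' =>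
        ha0 (hinj ((hSK (h'.trans (map_zero _).symm)).trans (map_zero _).symm))
      rw [← mul_div_cancel₀ (algebraMap S K (algebraMap R S s)) haK]
      refine Submodule.mul_mem_mul
        (Submodule.mem_map_of_mem (f := Algebra.linearMap S K) (Ideal.mem_map_of_mem _ ha)) ?_
      rw [Submodule.mem_div_iff_forall_mul_mem]
      rintro _ ⟨y, hy, rfl⟩
      induction hy using Submodule.span_induction with
      | mem y hy =>
        obtain ⟨z, hz, rfl⟩ := hy
        obtain ⟨r, hr⟩ := Ideal.mem_span_singleton'.mp (hs z hz)
        refine Submodule.mem_one.mpr ⟨algebraMap R S r, ?_⟩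
        rw [Algebra.linearMap_apply, div_mul_eq_mul_div, eq_div_iff haK, ← map_mul, ← map_mul, hr,
          map_mul, map_mul]
      | zero => simp
      | add x y _ _ hx hy => rw [map_add, mul_add]; exact add_mem hx hy
      | smul r x _ hx => rw [map_smul, mul_smul_comm]; exact Submodule.smul_mem _ _ hx
    | zero => simp
    | add x y _ _ hx hy => rw [map_add, map_add]; exact add_mem hx hy
    | smul r x _ hx =>
      rw [smul_eq_mul, map_mul, map_mul, ← Algebra.smul_def]; exact Submodule.smul_mem _ _ hx
  -- No prime avoiding `t` contains this ideal, so a power of `t`, a unit of `S`, lies in it; hence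
  -- `I · I⁻¹ = 1`.
  obtain ⟨N, hN⟩ : t ∈ (Ideal.span {s : R | ∃ a ∈ P, ∀ z ∈ P, s * z ∈ Ideal.span {a}}).radical := by
    rw [Ideal.radical_eq_sInf, Ideal.mem_sInf]
    rintro q ⟨hq, hqp⟩
    by_contra htq
    obtain ⟨a, ha, s, hs, hsz⟩ := h q hqp htq
    exact hs (hq (Ideal.subset_span ⟨a, ha, hsz⟩))
  have hone : I * (1 / I) = 1 := by
    refine le_antisymm Submodule.mul_one_div_le_one (Submodule.one_le.mpr ?_)
    obtain ⟨w, hw⟩ := (IsLocalization.Away.algebraMap_isUnit (S := S) t).pow N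
    have h1 := Submodule.smul_mem _ ((w⁻¹ : Sˣ) : S) (hmul _ hN)
    rwa [map_pow, ← hw, Algebra.smul_def, ← map_mul, Units.inv_mul, map_one] at h1
  have hI : Module.Invertible S I :=
    inferInstanceAs (Module.Invertible S (Units.mkOfMulEqOne I (1 / I) hone))
  have e := Submodule.equivMapOfInjective (Algebra.linearMap S K) hSK (P.map (algebraMap R S))
  exact .congr e.symm

/-- Choose a prime element `t ∈ 𝔪 \ 𝔪²`. Either `P = (t)`, or Nagata's lemma reduces the claim to
`R[1/t]`. Primes avoiding `t` are not maximal, so by induction `P` is locally principal there and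
its extension is invertible. Finite free syzygies make it stably free, and a stably free invertible
module is free. -/
theorem isPrincipal_of_height_eq_one_aux (d : ℕ) (R : Type u) [CommRing R] [IsDomain R]
    [IsLocalRing R] [IsRegularRing R] (hd : ringKrullDim R = d) (P : Ideal R) [P.IsPrime]
    (hP : P.height = 1) : P.IsPrincipal := by
  induction d using Nat.strong_induction_on generalizing R with
  | _ d ih =>
  have := IsRegularLocalRing.of_isRegularRing_of_isLocalRing R
  have hP0 : P ≠ ⊥ := by
    rintro rfl
    rw [Ideal.height_bot] at hP
    exact zero_ne_one hP
  have hbot : maximalIdeal R ≠ ⊥ := fun h =>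
    hP0 (eq_bot_iff.mpr (h ▸ le_maximalIdeal (Ideal.IsPrime.ne_top ‹_›)))
  obtain ⟨t, ht, ht2⟩ := Set.not_subset.mp (maximalIdeal_not_le_sq hbot)
  have ht0 : t ≠ 0 := fun h => ht2 (h ▸ zero_mem _)
  have := (isRegularLocalRing_quotient ht ht2).1
  have := isDomain_of_isRegularLocalRing (R ⧸ Ideal.span {t})
  have hspan : (Ideal.span {t}).IsPrime := (Ideal.Quotient.isDomain_iff_prime _).mp this
  have htprime : Prime t := (Ideal.span_singleton_prime ht0).mp hspan
  by_cases htP : t ∈ P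
  · exact ⟨t, P.eq_span_singleton_of_height_eq_one hP htP htprime⟩
  refine P.isPrincipal_of_isPrincipal_localizationAway_of_prime htprime htP ?_
  let S := Localization.Away t
  have hinv : Module.Invertible S (P.map (algebraMap R S)) := by
    refine invertible_map_away ht0 P hP0 fun q hq htq => ?_
    by_cases hPq : P ≤ q
    · have hqm : q < maximalIdeal R :=
        lt_of_le_of_ne (le_maximalIdeal hq.ne_top) fun h => htq (h ▸ ht)
      have hdim : ringKrullDim (Localization.AtPrime q) < d := by
        rw [IsLocalization.AtPrime.ringKrullDim_eq_height q, ← hd,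
          ← maximalIdeal_height_eq_ringKrullDim]
        exact_mod_cast Ideal.height_strict_mono_of_isPrime_of_isPrime hqm
      obtain ⟨e, he⟩ := exists_nat_ringKrullDim_eq (Localization.AtPrime q)
      have hdisj : Disjoint (q.primeCompl : Set R) (P : Set R) :=
        Set.disjoint_left.mpr fun x hx hxP => hx (hPq hxP)
      have := isRegularRing_localization (R := R) q.primeCompl
      have := IsLocalization.isPrime_of_isPrime_disjoint q.primeCompl
        (Localization.AtPrime q) P ‹_› hdisj
      refine exists_mul_mem_span_singleton_of_isPrincipal_map P q
        (ih e (by rw [he] at hdim; exact_mod_cast hdim) (Localization.AtPrime q) he _ ?_)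
      rw [IsLocalization.height_map_of_disjoint q.primeCompl P hdisj, hP]
    · obtain ⟨a, ha, haq⟩ := Set.not_subset.mp hPq
      -- Off the zero locus of `P` the localised ideal is the unit ideal, generated by `a ∈ P \ q`.
      exact ⟨a, ha, a, haq, fun z _ => Ideal.mul_mem_right _ _ (Ideal.mem_span_singleton_self a)⟩
  let e : S ⊗[R] P ≃ₗ[S] P.map (algebraMap R S) :=
    (IsLocalizedModule.isBaseChange (Submonoid.powers t) S (Algebra.idealMap S P)).equiv
  have : Module.Invertible S (S ⊗[R] P) := .congr e.symm
  have := (syzygyFree_of_isRegularLocalRing d R hd P).isStablyFree_tensorProduct S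
  have := Module.free_of_isStablyFree_of_invertible S (S ⊗[R] P)
  obtain ⟨f⟩ := Module.Invertible.free_iff_linearEquiv.mp this
  let g : S ≃ₗ[S] P.map (algebraMap R S) := f.symm ≪≫ₗ e
  refine ⟨g 1, le_antisymm (fun z hz => ?_) (Submodule.span_le.mpr (by simp))⟩
  refine Submodule.mem_span_singleton.mpr ⟨g.symm ⟨z, hz⟩, ?_⟩
  rw [← Submodule.coe_smul, ← map_smul, smul_eq_mul, mul_one, LinearEquiv.apply_symm_apply]

theorem uniqueFactorizationMonoid_of_isRegularRing (R : Type u) [CommRing R] [IsDomain R]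
    [IsLocalRing R] [IsRegularRing R] : UniqueFactorizationMonoid R := by
  obtain ⟨d, hd⟩ := exists_nat_ringKrullDim_eq R
  exact .of_forall_isPrincipal_of_height_eq_one fun P _ => isPrincipal_of_height_eq_one_aux d R hd P

end Factoriality


/-! ### Stalks of divisorial sheaves on a locally factorial scheme -/

section DivisorialStalk

open TopologicalSpace

variable {A : Type u} [CommRing A] [IsDomain A] [IsNoetherianRing A]

theorem ord_zpow (y : PrimeDivisor A) (φ : FractionRing A) (m : ℤ) :
    ord y (φ ^ m) = m * ord y φ := by
  rw [ord, map_zpow₀, WithZero.log_zpow, zsmul_eq_mul]; rfl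

theorem ord_algebraMap_eq_zero (y : PrimeDivisor A) {a : A} (ha : a ∉ y.1.asIdeal) :
    ord y (algebraMap A (FractionRing A) a) = 0 := by
  rw [IsScalarTower.algebraMap_apply A (Localization.AtPrime y.1.asIdeal) (FractionRing A), ord,
    Ring.ordFrac_of_isUnit, WithZero.log_one]
  exact IsLocalization.map_units _ (⟨a, ha⟩ : y.1.asIdeal.primeCompl)

variable [IsIntegrallyClosed A]

theorem mem_range_of_ord_nonneg (y : PrimeDivisor A) {φ : FractionRing A} (hφ : φ ≠ 0)
    (h : 0 ≤ ord y φ) :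
    ∃ a : Localization.AtPrime y.1.asIdeal, algebraMap _ (FractionRing A) a = φ := by
  apply IsDiscreteValuationRing.exists_lift_of_le_one
  have h0 : Ring.ordFrac (Localization.AtPrime y.1.asIdeal) φ ≠ 0 := by simpa using hφ
  rw [ord, ← WithZero.log_one, WithZero.log_le_log one_ne_zero h0, Ring.ordFrac_eq_valuation_inv] at h
  exact (one_le_inv₀ (by simpa [zero_lt_iff] using hφ)).mp h

theorem ord_algebraMap_eq_one (y : PrimeDivisor A) {a s : A} (ha : a ∈ y.1.asIdeal)
    (hs : s ∉ y.1.asIdeal) (h : ∀ z ∈ y.1.asIdeal, s * z ∈ Ideal.span {a}) :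
    ord y (algebraMap A (FractionRing A) a) = 1 := by
  rw [IsScalarTower.algebraMap_apply A (Localization.AtPrime y.1.asIdeal) (FractionRing A), ord,
    Ring.ordFrac_irreducible, WithZero.log_exp]
  rw [IsDiscreteValuationRing.irreducible_iff_uniformizer,
    ← Localization.AtPrime.map_eq_maximalIdeal]
  refine le_antisymm (Ideal.map_le_iff_le_comap.mpr fun z hz => ?_)
    ((Ideal.span_singleton_le_iff_mem _).mpr (Ideal.mem_map_of_mem _ ha))
  have h1 := Ideal.mem_map_of_mem (algebraMap A (Localization.AtPrime y.1.asIdeal)) (h z hz)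
  rw [Ideal.map_span, Set.image_singleton, map_mul] at h1
  exact (Ideal.unit_mul_mem_iff_mem _
    (IsLocalization.map_units (Localization.AtPrime y.1.asIdeal)
      (⟨s, hs⟩ : y.1.asIdeal.primeCompl))).mp h1

/-- An irreducible factor of a reduced denominator would define a prime divisor through `x` along
which `φ` has a pole. -/
theorem mem_range_of_mem_divisorialSections_zero {x : PrimeSpectrum A}
    [UniqueFactorizationMonoid (Localization.AtPrime x.asIdeal)] {U : Opens (PrimeSpectrum A)} (hx : x ∈ U) {φ : FractionRing A}
    (hφ : φ ∈ divisorialSections 0 U) :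
    ∃ a : Localization.AtPrime x.asIdeal, algebraMap _ (FractionRing A) a = φ := by
  let R := Localization.AtPrime x.asIdeal
  have : IsDomain R :=
    IsLocalization.isDomain_of_le_nonZeroDivisors _ x.asIdeal.primeCompl_le_nonZeroDivisors
  by_cases hφ0 : φ = 0
  · exact ⟨0, by rw [map_zero, hφ0]⟩
  obtain ⟨a, b, hab, rfl⟩ := IsFractionRing.exists_reduced_fraction R φ
  by_cases hb : IsUnit (b : R)
  · obtain ⟨w, hw⟩ := hb
    refine ⟨a * (w⁻¹ : Rˣ), ?_⟩
    rw [IsLocalization.eq_mk'_iff_mul_eq, ← map_mul, ← hw, mul_assoc, Units.inv_mul, mul_one]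
  exfalso
  obtain ⟨ϖ, hϖ, hϖb⟩ := WfDvdMonoid.exists_irreducible_factor hb (nonZeroDivisors.ne_zero b.2)
  have hϖp := hϖ.prime
  let Q : Ideal R := Ideal.span {ϖ}
  have hQ : Q.IsPrime := (Ideal.span_singleton_prime hϖp.ne_zero).mpr hϖp
  have hQh : Q.height = 1 := by
    refine le_antisymm (Ideal.height_le_one_of_isPrincipal_of_mem_minimalPrimes Q Q
      (by rw [Ideal.minimalPrimes_eq_subsingleton_self]; rfl)) ?_
    rw [Order.one_le_iff_pos, ← Ideal.height_bot (R := R)]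
    exact Ideal.height_strict_mono_of_isPrime_of_isPrime
      (bot_lt_iff_ne_bot.mpr (mt Ideal.span_singleton_eq_bot.mp hϖp.ne_zero))
  let y : PrimeDivisor A := ⟨⟨Q.under A, inferInstance⟩,
    (IsLocalization.height_under x.asIdeal.primeCompl Q).trans hQh⟩
  have hyx : y.1.asIdeal ≤ x.asIdeal := fun z hz => by
    by_contra hzx
    exact hQ.ne_top (Ideal.eq_top_of_isUnit_mem _ hz
      (IsLocalization.map_units R (⟨z, hzx⟩ : x.asIdeal.primeCompl)))
  -- The generic point `y` specialises to `x`, and open sets are stable under generisation.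
  have hyU : y.1 ∈ U := ((PrimeSpectrum.le_iff_specializes y.1 x).mp hyx).mem_open U.2 hx
  have h1 := hφ hφ0 y hyU
  rw [Finsupp.zero_apply, add_zero] at h1
  obtain ⟨c, hc⟩ := mem_range_of_ord_nonneg y hφ0 (by exact_mod_cast h1)
  obtain ⟨c, s, rfl⟩ := IsLocalization.exists_mk'_eq y.1.asIdeal.primeCompl c
  have h2 : a * algebraMap A R s = b * algebraMap A R c := by
    apply IsFractionRing.injective R (FractionRing A)
    have h3 := IsLocalization.mk'_spec (Localization.AtPrime y.1.asIdeal) c s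
    have h4 := IsLocalization.mk'_spec (FractionRing A) a b
    have h5 := congrArg (algebraMap _ (FractionRing A)) h3
    rw [map_mul, ← IsScalarTower.algebraMap_apply, ← IsScalarTower.algebraMap_apply, hc] at h5
    rw [map_mul, map_mul, ← IsScalarTower.algebraMap_apply, ← IsScalarTower.algebraMap_apply,
      ← h5, ← h4]
    ring
  have h6 : ϖ ∣ a * algebraMap A R s := h2 ▸ hϖb.mul_right _
  rcases hϖp.dvd_or_dvd h6 with h7 | h7
  · exact hϖp.not_isUnit (hab h7 hϖb)
  · exact s.2 (Ideal.mem_span_singleton.mpr h7)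

/-- Locally at `x`, every prime divisor is the divisor of a rational function. -/
theorem exists_ord_eq_single [DecidableEq (PrimeDivisor A)] (x : PrimeSpectrum A)
    [UniqueFactorizationMonoid (Localization.AtPrime x.asIdeal)] (y : PrimeDivisor A) :
    ∃ U : Opens (PrimeSpectrum A), x ∈ U ∧ ∃ g : FractionRing A, g ≠ 0 ∧
      ∀ y' : PrimeDivisor A, y'.1 ∈ U → ord y' g = if y' = y then 1 else 0 := by
  by_cases hyx : y.1.asIdeal ≤ x.asIdeal
  · have : IsDomain (Localization.AtPrime x.asIdeal) :=
      IsLocalization.isDomain_of_le_nonZeroDivisors _ x.asIdeal.primeCompl_le_nonZeroDivisors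
    have hdisj : Disjoint (x.asIdeal.primeCompl : Set A) (y.1.asIdeal : Set A) :=
      Set.disjoint_left.mpr fun z hz hzP => hz (hyx hzP)
    have := IsLocalization.isPrime_of_isPrime_disjoint x.asIdeal.primeCompl
      (Localization.AtPrime x.asIdeal) y.1.asIdeal inferInstance hdisj
    obtain ⟨a, ha, s, hs, hsa⟩ := exists_mul_mem_span_singleton_of_isPrincipal_map y.1.asIdeal
      x.asIdeal (UniqueFactorizationMonoid.isPrincipal_of_height_eq_one
        (by rw [IsLocalization.height_map_of_disjoint x.asIdeal.primeCompl _ hdisj, y.2]))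
    have ha0 : a ≠ 0 := by
      rintro rfl
      have hy0 : y.1.asIdeal ≠ ⊥ := fun h0 => Ideal.ne_bot_of_height_eq_one y.2 h0
      obtain ⟨z, hz, hz0⟩ := Submodule.exists_mem_ne_zero_of_ne_bot hy0
      have h1 := hsa z hz
      rw [Ideal.span_singleton_zero, Ideal.mem_bot] at h1
      exact hs ((mul_eq_zero.mp h1).resolve_right hz0 ▸ zero_mem _)
    -- Where `s` is invertible, `a` generates the ideal of `y`, so its divisor there is exactly `y`.
    refine ⟨PrimeSpectrum.basicOpen s, hs, algebraMap A _ a, by simpa using ha0, fun y' hy' => ?_⟩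
    split_ifs with h
    · subst h
      exact ord_algebraMap_eq_one _ ha hy' hsa
    · refine ord_algebraMap_eq_zero _ fun hay' => h (Subtype.ext (PrimeSpectrum.ext ?_))
      have hle : y.1.asIdeal ≤ y'.1.asIdeal := fun z hz =>
        (y'.1.2.mem_or_mem ((Ideal.span_singleton_le_iff_mem _).mpr hay' (hsa z hz))).resolve_left hy'
      by_contra hne
      have := Ideal.height_strict_mono_of_isPrime_of_isPrime (lt_of_le_of_ne hle (Ne.symm hne))
      rw [y.2, y'.2] at this
      exact lt_irrefl _ this
  · obtain ⟨s, hsy, hsx⟩ := Set.not_subset.mp hyx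
    refine ⟨PrimeSpectrum.basicOpen s, hsx, 1, one_ne_zero, fun y' hy' => ?_⟩
    rw [if_neg (by rintro rfl; exact hy' hsy)]
    simp [ord]

theorem exists_ord_eq (x : PrimeSpectrum A)
    [UniqueFactorizationMonoid (Localization.AtPrime x.asIdeal)] (E : PrimeDivisor A →₀ ℤ) :
    ∃ U : Opens (PrimeSpectrum A), x ∈ U ∧ ∃ g : FractionRing A, g ≠ 0 ∧
      ∀ y : PrimeDivisor A, y.1 ∈ U → ord y g = E y := by
  classical
  induction E using Finsupp.induction_linear with
  | zero => exact ⟨⊤, trivial, 1, one_ne_zero, fun y _ => by simp [ord]⟩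
  | add E F hE hF =>
    obtain ⟨U, hU, g, hg, hgE⟩ := hE
    obtain ⟨V, hV, h, hh, hhF⟩ := hF
    refine ⟨U ⊓ V, ⟨hU, hV⟩, g * h, mul_ne_zero hg hh, fun y hy => ?_⟩
    rw [ord_mul y hg hh, hgE y hy.1, hhF y hy.2, Finsupp.add_apply]
  | single y m =>
    obtain ⟨U, hU, g, hg, hgy⟩ := exists_ord_eq_single x y
    refine ⟨U, hU, g ^ m, zpow_ne_zero m hg, fun y' hy' => ?_⟩
    rw [ord_zpow, hgy y' hy', Finsupp.single_apply]
    by_cases h : y' = y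
    · rw [if_pos h, if_pos h.symm, mul_one]
    · rw [if_neg h, if_neg (Ne.symm h), mul_zero]

/-- The stalks of divisorial sheaves on a locally factorial scheme are free of rank one. -/
theorem exists_generator_divisorialSections (x : PrimeSpectrum A)
    [UniqueFactorizationMonoid (Localization.AtPrime x.asIdeal)] (D : RDivisor A) :
    ∃ g : FractionRing A, g ≠ 0 ∧ ∀ φ : FractionRing A,
      (∃ U : Opens (PrimeSpectrum A), x ∈ U ∧ φ ∈ divisorialSections D U) ↔
        ∃ r : Localization.AtPrime x.asIdeal, φ = g * algebraMap _ (FractionRing A) r := by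
  -- Orders are integers, so `ord φ + D ≥ 0` amounts to `ord φ ≥ -⌊D⌋`; a generator has order
  -- exactly `-⌊D⌋`.
  obtain ⟨U, hU, g, hg, hgD⟩ := exists_ord_eq x (D.mapRange (fun r => -⌊r⌋) (by simp))
  refine ⟨g, hg, fun φ => ⟨?_, ?_⟩⟩
  · rintro ⟨V, hV, hφ⟩
    have key : g⁻¹ * φ ∈ divisorialSections 0 (U ⊓ V) := fun h y hy => by
      have hφ0 := right_ne_zero_of_mul h
      have h1 := hφ hφ0 y hy.2
      have h2 := hgD y hy.1
      rw [Finsupp.mapRange_apply] at h2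
      have h3 : -(ord y φ) ≤ ⌊D y⌋ := Int.le_floor.mpr (by push_cast; linarith)
      have h4 : ord y (g⁻¹) = - ord y g := by simpa using ord_zpow y g (-1)
      rw [ord_mul y (inv_ne_zero hg) hφ0, h4, h2, Finsupp.zero_apply, add_zero]
      exact_mod_cast (by linarith : 0 ≤ - -⌊D y⌋ + ord y φ)
    obtain ⟨r, hr⟩ := mem_range_of_mem_divisorialSections_zero (x := x) (U := U ⊓ V) ⟨hU, hV⟩ key
    exact ⟨r, by rw [hr, mul_inv_cancel_left₀ hg]⟩
  · rintro ⟨r, rfl⟩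
    obtain ⟨V, hV, hr⟩ := exists_mem_divisorialSections_zero x r
    refine ⟨U ⊓ V, ⟨hU, hV⟩, ?_⟩
    rw [← add_zero D]
    refine mul_mem_divisorialSections (fun _ y hy => ?_)
      (divisorialSections_mono _ inf_le_right hr)
    rw [hgD y hy.1, Finsupp.mapRange_apply]
    push_cast
    linarith [Int.floor_le (D y)]

end DivisorialStalk


/-! ### Finiteness of Frobenius -/

section FrobeniusFinite

theorem ringHom_finite_iff_exists_family {R S : Type*} [CommRing R] [CommRing S] (f : R →+* S) :
    f.Finite ↔ ∃ (m : ℕ) (t : Fin m → S), ∀ b : S, ∃ c : Fin m → R, ∑ i, f (c i) * t i = b := by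
  let _ : Algebra R S := f.toAlgebra
  refine Module.finite_def.trans (Submodule.fg_iff_exists_fin_generating_family.trans ?_)
  simp_rw [eq_top_iff, SetLike.le_def, Submodule.mem_span_range_iff_exists_fun]
  exact exists_congr fun m => exists_congr fun t =>
    ⟨fun h b => h (x := b) Submodule.mem_top, fun h b _ => h b⟩

/-- Frobenius is integral through `X^p - b`. It is of finite type because its restriction to `k`
factors through the Frobenius of `k`, which is surjective for perfect `k`. -/
theorem frobenius_finite_of_finiteType (p : ℕ) [Fact p.Prime] (k B : Type*) [Field k] [CharP k p]
    [PerfectField k] [CommRing B] [CharP B p] [Algebra k B] [Algebra.FiniteType k B] :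
    (frobenius B p).Finite := by
  refine RingHom.IsIntegral.to_finite (fun b => ?_) ?_
  · refine ⟨Polynomial.X ^ p - Polynomial.C b, Polynomial.monic_X_pow_sub_C b
      (Fact.out : p.Prime).ne_zero, ?_⟩
    simp [frobenius_def]
  · have := PerfectField.toPerfectRing (K := k) p
    refine RingHom.FiniteType.of_comp_finiteType (f := algebraMap k B) ?_
    rw [← RingHom.frobenius_comm]
    exact RingHom.FiniteType.comp
      (RingHom.finiteType_algebraMap.mpr inferInstance)
      (RingHom.FiniteType.of_surjective _ (surjective_frobenius k p))

theorem frobenius_finite_of_isLocalization (p : ℕ) [Fact p.Prime] {B A : Type*} [CommRing B]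
    [CommRing A] [CharP B p] [CharP A p] [Algebra B A] (M : Submonoid B) [IsLocalization M A]
    (h : (frobenius B p).Finite) : (frobenius A p).Finite := by
  rw [ringHom_finite_iff_exists_family] at h ⊢
  obtain ⟨m, t, ht⟩ := h
  refine ⟨m, fun i => algebraMap B A (t i), fun a => ?_⟩
  obtain ⟨b, s, rfl⟩ := IsLocalization.exists_mk'_eq M a
  -- The denominator must be a `p`-th power: `b/s = b s^(p-1) / s^p`.
  obtain ⟨c, hc⟩ := ht (b * s ^ (p - 1))
  refine ⟨fun i => IsLocalization.mk' A (c i) s, ?_⟩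
  refine ((IsLocalization.map_units A s).pow p).mul_right_cancel ?_
  have hp : (s : B) ^ p = s ^ (p - 1) * s := by
    rw [← pow_succ, Nat.sub_add_cancel (Fact.out : p.Prime).one_le]
  have h2 : IsLocalization.mk' A b s * algebraMap B A s ^ p =
      algebraMap B A (b * s ^ (p - 1)) := by
    rw [← map_pow, hp, map_mul, map_mul, mul_left_comm, IsLocalization.mk'_spec, mul_comm]
  rw [h2, ← hc, map_sum, Finset.sum_mul]
  refine Finset.sum_congr rfl fun i _ => ?_
  rw [map_mul, frobenius_def, frobenius_def, map_pow, mul_right_comm, ← mul_pow,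
    IsLocalization.mk'_spec]

theorem iterateFrobenius_finite (p : ℕ) [Fact p.Prime] {R : Type*} [CommRing R] [CharP R p]
    (h : (frobenius R p).Finite) (j : ℕ) : (iterateFrobenius R p j).Finite := by
  induction j with
  | zero => rw [iterateFrobenius_zero]; exact RingHom.Finite.id R
  | succ j ih =>
    have : iterateFrobenius R p (j + 1) = (frobenius R p).comp (iterateFrobenius R p j) := by
      ext x
      rw [RingHom.comp_apply, iterateFrobenius_def, iterateFrobenius_def, frobenius_def, pow_succ, pow_mul]
    rw [this]
    exact RingHom.Finite.comp h ih

theorem IsEssentiallySmooth.frobenius_finite_localization {p : ℕ} [Fact p.Prime] {k : Type v}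
    [Field k] [CharP k p] [PerfectField k] {A : Type u} [CommRing A] [Nontrivial A] [Algebra k A]
    (hA : IsEssentiallySmooth k A) (M : Submonoid A) [CharP (Localization M) p] :
    (frobenius (Localization M) p).Finite := by
  obtain ⟨B, _, _, _, N, _, _, _⟩ := hA
  have : CharP A p := charP_of_injective_algebraMap (algebraMap k A).injective p
  have : Nontrivial B := (algebraMap B A).domain_nontrivial
  have : CharP B p := charP_of_injective_algebraMap (algebraMap k B).injective p
  exact frobenius_finite_of_isLocalization p M
    (frobenius_finite_of_isLocalization p N (frobenius_finite_of_finiteType p k B))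

end FrobeniusFinite


/-! ### Leading components of Witt vectors, and the map `Wₙ(R) → R` -/

section WittCoeff

variable {p : ℕ} [Fact p.Prime] {R : Type*} [CommRing R]

/-- Both vectors are values of `V^j`, which is additive, and the `0`-th component is additive. -/
theorem witt_coeff_add_of_coeff_eq_zero (x y : WittVector p R) (j : ℕ)
    (hx : ∀ i < j, x.coeff i = 0) (hy : ∀ i < j, y.coeff i = 0) :
    (x + y).coeff j = x.coeff j + y.coeff j := by
  rw [WittVector.eq_iterate_verschiebung hx, WittVector.eq_iterate_verschiebung hy,
    ← iterate_map_add]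
  have h (z : WittVector p R) : (WittVector.verschiebung^[j] z).coeff j = z.coeff 0 := by
    simpa using WittVector.iterate_verschiebung_coeff z j 0
  rw [h, h, h, WittVector.add_coeff_zero]

/-- This is the projection formula `a · V^j z = V^j (F^j a · z)`, and `F` raises components to the
`p`-th power in characteristic `p`. -/
theorem witt_coeff_mul_of_coeff_eq_zero [CharP R p] (a y : WittVector p R) (j : ℕ)
    (hy : ∀ i < j, y.coeff i = 0) :
    (a * y).coeff j = a.coeff 0 ^ p ^ j * y.coeff j := by
  rw [WittVector.eq_iterate_verschiebung hy, mul_comm a, WittVector.iterate_verschiebung_mul_left]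
  have h (z : WittVector p R) : (WittVector.verschiebung^[j] z).coeff j = z.coeff 0 := by
    simpa using WittVector.iterate_verschiebung_coeff z j 0
  rw [h, h, WittVector.mul_coeff_zero, WittVector.iterate_frobenius_coeff, mul_comm]

variable {n : ℕ}

theorem truncated_coeff_add_of_coeff_eq_zero (x y : TruncatedWittVector p n R) (j : Fin n)
    (hx : ∀ i < j, x.coeff i = 0) (hy : ∀ i < j, y.coeff i = 0) :
    (x + y).coeff j = x.coeff j + y.coeff j := by
  have hout {z : TruncatedWittVector p n R} (hz : ∀ i < j, z.coeff i = 0) (i : ℕ)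
      (hi : i < j) : z.out.coeff i = 0 :=
    (TruncatedWittVector.coeff_out z ⟨i, hi.trans j.2⟩).trans (hz _ hi)
  have h := witt_coeff_add_of_coeff_eq_zero x.out y.out j (hout hx) (hout hy)
  rwa [TruncatedWittVector.coeff_out, TruncatedWittVector.coeff_out,
    ← WittVector.coeff_truncateFun, WittVector.truncateFun_add,
    TruncatedWittVector.truncateFun_out, TruncatedWittVector.truncateFun_out] at h

theorem truncated_coeff_mul_of_coeff_eq_zero [NeZero n] [CharP R p]
    (a y : TruncatedWittVector p n R) (j : Fin n) (hy : ∀ i < j, y.coeff i = 0) :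
    (a * y).coeff j = a.coeff 0 ^ p ^ (j : ℕ) * y.coeff j := by
  have h := witt_coeff_mul_of_coeff_eq_zero a.out y.out j fun i hi =>
    (TruncatedWittVector.coeff_out y ⟨i, hi.trans j.2⟩).trans (hy _ hi)
  rwa [TruncatedWittVector.coeff_out, show a.out.coeff 0 = a.coeff 0 from
    TruncatedWittVector.coeff_out a 0, ← WittVector.coeff_truncateFun,
    WittVector.truncateFun_mul, TruncatedWittVector.truncateFun_out,
    TruncatedWittVector.truncateFun_out] at h

variable (p n R) in
/-- The ring homomorphism `Wₙ(R) → R` reading off the `0`-th component. -/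
noncomputable def coeffZero [NeZero n] [CharP R p] : TruncatedWittVector p n R →+* R where
  toFun a := a.coeff 0
  map_one' := by
    rw [← map_one (WittVector.truncate n), WittVector.coeff_truncate]
    exact WittVector.one_coeff_zero p R
  map_zero' := TruncatedWittVector.coeff_zero _ _ _ 0
  map_add' x y := truncated_coeff_add_of_coeff_eq_zero x y 0 (by simp) (by simp)
  map_mul' x y := by
    rw [truncated_coeff_mul_of_coeff_eq_zero x y 0 (by simp)]
    simp

section CoeffZero

variable [NeZero n] [CharP R p]

theorem coeffZero_apply (a : TruncatedWittVector p n R) : coeffZero p R n a = a.coeff 0 := rfl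

theorem coeffZero_truncate_teichmuller (r : R) :
    coeffZero p R n (WittVector.truncate n (WittVector.teichmuller p r)) = r := by
  rw [coeffZero_apply, WittVector.coeff_truncate]
  exact WittVector.teichmuller_coeff_zero p r

theorem coeffZero_surjective : Function.Surjective (coeffZero p R n) :=
  fun r => ⟨_, coeffZero_truncate_teichmuller r⟩

/-- If `a₀ = 0`, each further factor `a` kills the leading component, so the first `k` components of
`a ^ k` vanish and `a ^ n = 0`. -/
theorem ker_coeffZero_le_nilradical :
    RingHom.ker (coeffZero p R n) ≤ nilradical (TruncatedWittVector p n R) := by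
  intro a ha
  rw [RingHom.mem_ker, coeffZero_apply] at ha
  have h (k : ℕ) : ∀ i : Fin n, (i : ℕ) < k → (a ^ k).coeff i = 0 := by
    induction k with
    | zero => simp
    | succ k ih =>
      intro i hi
      rw [pow_succ', truncated_coeff_mul_of_coeff_eq_zero a (a ^ k) i fun l hl => ih l (by
        have : (l : ℕ) < i := hl
        omega), ha, zero_pow (pow_ne_zero _ (Fact.out : p.Prime).ne_zero), zero_mul]
  refine ⟨n, TruncatedWittVector.ext fun i => ?_⟩
  rw [h n i i.2, TruncatedWittVector.coeff_zero]

instance : IsLocalHom (coeffZero p R n) where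
  map_nonunit a ha := by
    obtain ⟨b, hb⟩ := coeffZero_surjective (p := p) (n := n) (ha.unit⁻¹ : Rˣ).1
    have h : a * b - 1 ∈ RingHom.ker (coeffZero p R n) := by
      rw [RingHom.mem_ker, map_sub, map_mul, hb, map_one, IsUnit.mul_val_inv, sub_self]
    have := (mem_nilradical.mp (ker_coeffZero_le_nilradical h)).isUnit_add_one
    rw [sub_add_cancel] at this
    exact isUnit_of_mul_isUnit_left this

theorem isLocalRing_truncatedWittVector [IsLocalRing R] :
    IsLocalRing (TruncatedWittVector p n R) :=
  RingHom.domain_isLocalRing (coeffZero p R n)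

/-- A surjection with nil kernel induces a homeomorphism of spectra. -/
theorem ringKrullDim_truncatedWittVector :
    ringKrullDim (TruncatedWittVector p n R) = ringKrullDim R := by
  rw [← PrimeSpectrum.topologicalKrullDim_eq_ringKrullDim,
    ← PrimeSpectrum.topologicalKrullDim_eq_ringKrullDim]
  exact ((PrimeSpectrum.isHomeomorph_comap (coeffZero p R n)
    (fun x => ⟨1, one_pos, by
      obtain ⟨a, ha⟩ := coeffZero_surjective (p := p) (n := n) x
      exact ⟨a, by rw [ha, pow_one]⟩⟩) ker_coeffZero_le_nilradical).topologicalKrullDim_eq _).symm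

end CoeffZero

end WittCoeff

/-! ### The graded pieces `F^j_* R` -/

section FrobeniusTwist

open RingTheory.Sequence

/-- The `Wₙ(R)`-module `R`, on which `a ∈ Wₙ(R)` acts as multiplication by `a₀ ^ p ^ j`. -/
def FrobeniusTwist (R : Type u) (_ : ℕ) : Type u := R

variable {p : ℕ} [Fact p.Prime] {R : Type u} [CommRing R] [CharP R p] {n : ℕ} [NeZero n] (j : ℕ)

instance : AddCommGroup (FrobeniusTwist R j) := inferInstanceAs (AddCommGroup R)

noncomputable instance : Module (TruncatedWittVector p n R) (FrobeniusTwist R j) :=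
  Module.compHom R ((iterateFrobenius R p j).comp (coeffZero p R n))

theorem frobeniusTwist_smul_def (a : TruncatedWittVector p n R) (r : FrobeniusTwist R j) :
    a • r = (show R from (a.coeff 0 ^ p ^ j * (show R from r))) := rfl

/-- The action factors through the surjection `Wₙ(R) → R`, so the submodules are the `R`-submodules
of `F^j_* R`, which is finite over `R`. -/
theorem isNoetherian_frobeniusTwist [IsNoetherianRing R] (h : (frobenius R p).Finite) :
    IsNoetherian (TruncatedWittVector p n R) (FrobeniusTwist R j) := by
  let _ : Algebra (TruncatedWittVector p n R) R := (coeffZero p R n).toAlgebra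
  let _ : Module R (FrobeniusTwist R j) := Module.compHom R (iterateFrobenius R p j)
  have hfin : Module.Finite R (FrobeniusTwist R j) := iterateFrobenius_finite p h j
  have : IsScalarTower (TruncatedWittVector p n R) R (FrobeniusTwist R j) :=
    ⟨fun a r s => by
      change iterateFrobenius R p j (coeffZero p R n a * r) * (show R from s) =
        iterateFrobenius R p j (coeffZero p R n a) * (iterateFrobenius R p j r * (show R from s))
      rw [map_mul, mul_assoc]⟩
  have hN : IsNoetherian R (FrobeniusTwist R j) := isNoetherian_of_isNoetherianRing_of_finite R _
  rw [isNoetherian_iff'] at hN ⊢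
  exact (Submodule.orderIsoOfAlgebraMapSurjective (M := FrobeniusTwist R j)
    (coeffZero_surjective (p := p) (R := R) (n := n))).symm.strictMono.wellFoundedGT

theorem isWeaklyRegular_frobeniusTwist (rs : List R) (h : IsWeaklyRegular R rs) :
    IsWeaklyRegular (FrobeniusTwist R j)
      (rs.map fun r => WittVector.truncate (p := p) n (WittVector.teichmuller p r)) := by
  refine (AddEquiv.isWeaklyRegular_congr (e := AddEquiv.refl R) (M₂ := FrobeniusTwist R j)
    ?_).mp (isWeaklyRegular_map_pow (p ^ j) rs h)
  rw [List.forall₂_map_left_iff, List.forall₂_map_right_iff, List.forall₂_same]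
  intro r _ x
  rw [frobeniusTwist_smul_def, ← coeffZero_apply, coeffZero_truncate_teichmuller]
  rfl

end FrobeniusTwist

/-! ### Filtration by leading components -/

section Filtration

open RingTheory.Sequence

variable {p : ℕ} [Fact p.Prime] {R K : Type u} [CommRing R] [CommRing K]
  [CharP K p] {n : ℕ} [NeZero n]
  [Algebra (TruncatedWittVector p n R) (TruncatedWittVector p n K)]

theorem truncated_coeff_smul_of_coeff_eq_zero [Algebra R K]
    (halg : ∀ a : TruncatedWittVector p n R,
      algebraMap _ (TruncatedWittVector p n K) a = truncatedMap p n (algebraMap R K) a)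
    (a : TruncatedWittVector p n R)
    (φ : TruncatedWittVector p n K) (j : Fin n) (hφ : ∀ i < j, φ.coeff i = 0) :
    (a • φ).coeff j = algebraMap R K (a.coeff 0 ^ p ^ (j : ℕ)) * φ.coeff j := by
  rw [Algebra.smul_def, halg, truncated_coeff_mul_of_coeff_eq_zero _ _ _ hφ, map_pow]
  rfl

/-- The Witt vectors in `N` whose first `j` components vanish. -/
def coeffFiltration (N : Submodule (TruncatedWittVector p n R) (TruncatedWittVector p n K))
    (j : ℕ) : Submodule (TruncatedWittVector p n R) (TruncatedWittVector p n K) where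
  carrier := {φ | φ ∈ N ∧ ∀ i : Fin n, (i : ℕ) < j → φ.coeff i = 0}
  zero_mem' := ⟨zero_mem _, fun i _ => TruncatedWittVector.coeff_zero _ _ _ i⟩
  add_mem' {φ ψ} hφ hψ := ⟨add_mem hφ.1 hψ.1, fun i hi => by
    rw [truncated_coeff_add_of_coeff_eq_zero φ ψ i
      (fun l hl => hφ.2 l (lt_trans hl hi)) (fun l hl => hψ.2 l (lt_trans hl hi)),
      hφ.2 i hi, hψ.2 i hi, add_zero]⟩
  smul_mem' a φ hφ := ⟨N.smul_mem a hφ.1, fun i hi => by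
    rw [Algebra.smul_def, truncated_coeff_mul_of_coeff_eq_zero _ _ _
      (fun l hl => hφ.2 l (lt_trans hl hi)), hφ.2 i hi, mul_zero]⟩

theorem coeffFiltration_succ_le
    (N : Submodule (TruncatedWittVector p n R) (TruncatedWittVector p n K)) (j : ℕ) :
    coeffFiltration N (j + 1) ≤ coeffFiltration N j :=
  fun _ hφ => ⟨hφ.1, fun i hi => hφ.2 i (hi.trans j.lt_succ_self)⟩

variable [IsDomain K] [CharP R p] [Algebra R K]
  (halg : ∀ a : TruncatedWittVector p n R,
    algebraMap _ (TruncatedWittVector p n K) a = truncatedMap p n (algebraMap R K) a)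
  (hinj : Function.Injective (algebraMap R K))
  (N : Submodule (TruncatedWittVector p n R) (TruncatedWittVector p n K)) (g : Fin n → K)
  (hg : ∀ i, g i ≠ 0)
  (hN : ∀ φ, φ ∈ N ↔ ∀ i, ∃ r : R, φ.coeff i = g i * algebraMap R K r)

include halg hinj hg hN in
-- The map is `φ ↦ φ_j / g_j`, well defined because `g_j ≠ 0` and `R` embeds in `K`.
theorem exists_coeffFiltration_exact (j : Fin n) :
    ∃ f : coeffFiltration N j →ₗ[TruncatedWittVector p n R] FrobeniusTwist R j,
      Function.Surjective f ∧
        Function.Exact (Submodule.inclusion (coeffFiltration_succ_le N j)) f := by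
  choose f hf using fun φ : coeffFiltration N j => (hN φ.1).mp φ.2.1 j
  have huniq (φ : coeffFiltration N j) (r : R) (h : φ.1.coeff j = g j * algebraMap R K r) :
      f φ = r := hinj (mul_left_cancel₀ (hg j) ((hf φ).symm.trans h))
  refine ⟨{
    toFun := f
    map_add' := fun φ ψ => huniq (φ + ψ) (f φ + f ψ) ?_
    map_smul' := fun a φ => huniq (a • φ) (a.coeff 0 ^ p ^ (j : ℕ) * f φ) ?_ },
    fun r => ?_, fun φ => ?_⟩
  · rw [map_add, mul_add, ← hf, ← hf]
    exact truncated_coeff_add_of_coeff_eq_zero _ _ _ φ.2.2 ψ.2.2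
  · change (a • φ.1).coeff j = _
    rw [truncated_coeff_smul_of_coeff_eq_zero halg a φ.1 j φ.2.2, hf]
    simp only [map_mul]
    ring
  -- Membership in `N` is componentwise, so a vector concentrated in position `j` is a preimage.
  · refine ⟨⟨TruncatedWittVector.mk p fun i => if i = j then g j * algebraMap R K r else 0,
      (hN _).mpr fun i => ?_, fun i hi => ?_⟩, huniq _ _ ?_⟩
    · rw [TruncatedWittVector.coeff_mk]
      split_ifs with h
      · exact ⟨r, by rw [h]⟩
      · exact ⟨0, by simp⟩
    · rw [TruncatedWittVector.coeff_mk, if_neg (fun h => (h ▸ hi).false)]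
    · rw [TruncatedWittVector.coeff_mk, if_pos rfl]
  · change f φ = 0 ↔ _
    constructor
    · intro h
      refine ⟨⟨φ.1, φ.2.1, fun i hi => ?_⟩, rfl⟩
      rcases Nat.lt_succ_iff_lt_or_eq.mp hi with hi | hi
      · exact φ.2.2 i hi
      · rw [Fin.ext hi, hf, h, map_zero, mul_zero]
    · rintro ⟨ψ, rfl⟩
      refine huniq _ _ ?_
      rw [map_zero, mul_zero]
      exact ψ.2.2 j j.val.lt_succ_self

include halg hinj hg hN in
theorem isNoetherian_and_isWeaklyRegular_of_coeff
    (rs : List (TruncatedWittVector p n R))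
    (hnoeth : ∀ j, IsNoetherian (TruncatedWittVector p n R) (FrobeniusTwist R j))
    (hreg : ∀ j, IsWeaklyRegular (FrobeniusTwist R j) rs) :
    IsNoetherian (TruncatedWittVector p n R) N ∧ IsWeaklyRegular N rs := by
  have key : ∀ j ≤ n, IsNoetherian (TruncatedWittVector p n R) (coeffFiltration N j) ∧
      IsWeaklyRegular (coeffFiltration N j) rs := by
    intro j hj
    -- Start from the zero module at `j = n` and add one graded piece at a time, down to `j = 0`.
    induction hj using Nat.decreasingInduction with
    | self =>
      have : Subsingleton (coeffFiltration N n) := by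
        refine subsingleton_of_forall_eq 0 fun φ => Subtype.ext (TruncatedWittVector.ext fun i => ?_)
        rw [φ.2.2 i i.2]
        exact (TruncatedWittVector.coeff_zero _ _ _ i).symm
      exact ⟨inferInstance, isWeaklyRegular_of_subsingleton rs _⟩
    | of_succ j hj ih =>
      obtain ⟨f, hf, hexact⟩ := exists_coeffFiltration_exact halg hinj N g hg hN ⟨j, hj⟩
      have := ih.1
      have := hnoeth j
      exact ⟨isNoetherian_of_range_eq_ker _ f (LinearMap.exact_iff.mp hexact).symm,
        isWeaklyRegular_of_exact rs _ f (Submodule.inclusion_injective _) hexact hf ih.2 (hreg j)⟩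
  have h0 : coeffFiltration N 0 = N := by
    ext φ
    exact ⟨fun h => h.1, fun h => ⟨h, fun i hi => (Nat.not_lt_zero _ hi).elim⟩⟩
  have := key 0 n.zero_le
  rwa [h0] at this

end Filtration

/-! ### Depth and dimension over `Wₙ(R)` -/

section CohenMacaulay

open RingTheory.Sequence

variable {p : ℕ} [Fact p.Prime] {n : ℕ} [NeZero n]

theorem isNoetherianRing_truncatedWittVector {R : Type u} [CommRing R] [IsDomain R]
    [IsNoetherianRing R] [CharP R p] (h : (frobenius R p).Finite) :
    IsNoetherianRing (TruncatedWittVector p n R) := by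
  -- The ring is treated as a module over itself, with `K = R`, all generators `1` and the empty
  -- sequence.
  have := (isNoetherian_and_isWeaklyRegular_of_coeff (p := p) (R := R) (K := R) (n := n)
    (fun a => rfl) Function.injective_id ⊤ (fun _ => 1) (fun _ => one_ne_zero)
    (fun φ => ⟨fun _ i => ⟨φ.coeff i, (one_mul _).symm⟩, fun _ => Submodule.mem_top⟩) []
    (fun j => isNoetherian_frobeniusTwist j h) (fun j => .nil _ _)).1
  exact isNoetherian_top_iff.mp this

/-- A finite module over a Noetherian local ring of dimension `d` is Cohen–Macaulay if it admits
a weakly regular sequence of length `d` in the maximal ideal. -/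
theorem depth_eq_supportDim_of_isWeaklyRegular {R M : Type*} [CommRing R] [IsLocalRing R]
    [IsNoetherianRing R] [AddCommGroup M] [Module R M] [Module.Finite R M] [Nontrivial M]
    (rs : List R) (hmem : ∀ r ∈ rs, r ∈ IsLocalRing.maximalIdeal R)
    (hreg : IsWeaklyRegular M rs) (hdim : ringKrullDim R ≤ rs.length) :
    (depth R M : WithBot ℕ∞) = Module.supportDim R M := by
  -- The quotient by a regular sequence is nonzero, so its dimension `dim M - l.length` is
  -- nonnegative.
  have hle : ∀ l : List R, IsRegular M l → (l.length : WithBot ℕ∞) ≤ Module.supportDim R M := by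
    intro l hl
    have := hl.quot_ofList_smul_nontrivial ⊤
    have : Nonempty (Module.support R (M ⧸ Ideal.ofList l • (⊤ : Submodule R M))) :=
      Module.nonempty_support_of_nontrivial.to_subtype
    rw [← Module.supportDim_add_length_eq_supportDim_of_isRegular l hl]
    exact le_add_of_nonneg_left Order.krullDim_nonneg
  refine le_antisymm ?_ ?_
  · obtain ⟨d, hd⟩ : ∃ d : ℕ∞, Module.supportDim R M = d := by
      exact (WithBot.ne_bot_iff_exists.mp (Module.supportDim_ne_bot_of_nontrivial R M)).imp
        fun _ h => h.symm
    rw [hd]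
    refine WithBot.coe_le_coe.mpr (sSup_le ?_)
    rintro _ ⟨l, -, hl, rfl⟩
    have := hle l hl
    rw [hd] at this
    exact WithBot.coe_le_coe.mp this
  · refine (Module.supportDim_le_ringKrullDim R M).trans (hdim.trans ?_)
    refine WithBot.coe_le_coe.mpr (le_sSup ⟨rs, hmem, ?_, rfl⟩)
    exact (IsLocalRing.isRegular_iff_isWeaklyRegular_of_subset_maximalIdeal hmem).mpr hreg

/-- Let `R` be a regular local ring of characteristic `p` with finite Frobenius, contained in a
domain `K`. A submodule of `Wₙ(K)` which is componentwise an invertible fractional ideal is a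
Cohen–Macaulay `Wₙ(R)`-module. -/
theorem isCohenMacaulay_of_coeff {R K : Type u} [CommRing R] [CommRing K] [IsDomain R] [IsDomain K]
    [IsLocalRing R] [IsNoetherianRing R] [CharP R p] [CharP K p] [Algebra R K]
    [Algebra (TruncatedWittVector p n R) (TruncatedWittVector p n K)]
    (halg : ∀ a : TruncatedWittVector p n R,
      algebraMap _ (TruncatedWittVector p n K) a = truncatedMap p n (algebraMap R K) a)
    (hinj : Function.Injective (algebraMap R K)) (hfrob : (frobenius R p).Finite)
    (rs : List R) (hrs : Ideal.ofList rs = IsLocalRing.maximalIdeal R)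
    (hdim : ringKrullDim R = rs.length)
    (N : Submodule (TruncatedWittVector p n R) (TruncatedWittVector p n K)) (g : Fin n → K)
    (hg : ∀ i, g i ≠ 0) (hN : ∀ φ, φ ∈ N ↔ ∀ i, ∃ r : R, φ.coeff i = g i * algebraMap R K r) :
    IsCohenMacaulay (TruncatedWittVector p n R) N := by
  have := isLocalRing_truncatedWittVector (p := p) (n := n) (R := R)
  have := isNoetherianRing_truncatedWittVector (n := n) hfrob
  have h := isNoetherian_and_isWeaklyRegular_of_coeff halg hinj N g hg hN
    (rs.map fun r => WittVector.truncate n (WittVector.teichmuller p r))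
    (fun j => isNoetherian_frobeniusTwist j hfrob)
    (fun j => isWeaklyRegular_frobeniusTwist j rs
      (isWeaklyRegular_of_ofList_eq_maximalIdeal R rs hrs hdim))
  have := h.1
  refine ⟨inferInstance, inferInstance, inferInstance, fun _ =>
    depth_eq_supportDim_of_isWeaklyRegular _ (fun a ha => ?_) h.2 ?_⟩
  · obtain ⟨r, hr, rfl⟩ := List.mem_map.mp ha
    rw [IsLocalRing.mem_maximalIdeal, mem_nonunits_iff]
    intro hu
    have := hu.map (coeffZero p R n)
    rw [coeffZero_truncate_teichmuller] at this
    exact (IsLocalRing.mem_maximalIdeal r).mp (hrs ▸ Ideal.subset_span hr) this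
  · rw [ringKrullDim_truncatedWittVector, hdim, List.length_map]

end CohenMacaulay


/-! ### Regularity of `A`, stalks by components, and the theorem -/

section Stalks

variable {A : Type u} [CommRing A] [IsNoetherianRing A]

theorem isRegularLocalRing_of_span_range_eq {R : Type*} [CommRing R] [IsLocalRing R]
    [IsNoetherianRing R] {d : ℕ} (t : Fin d → R) (hd : ringKrullDim R = d)
    (ht : Ideal.span (Set.range t) = IsLocalRing.maximalIdeal R) : IsRegularLocalRing R := by
  refine IsRegularLocalRing.of_spanFinrank_maximalIdeal_le R ?_
  rw [hd, ← ht]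
  have h : (Set.range t).ncard ≤ d := by
    rw [← Set.image_univ]
    exact (Set.ncard_image_le Set.finite_univ).trans (by rw [Set.ncard_univ, Nat.card_fin])
  exact_mod_cast (Submodule.spanFinrank_span_le_ncard_of_finite (Set.finite_range t)).trans h

/-- The condition is imposed at every point, also off the given divisors. Regularity thus holds at
all primes at once, as the induction over localisations in the proof of factoriality requires. -/
theorem isRegularRing_of_isSimpleNormalCrossing {S : Set (PrimeDivisor A)}
    (hS : IsSimpleNormalCrossing S) : IsRegularRing A := by
  rw [isRegularRing_iff]
  intro P hP
  obtain ⟨d, t, hd, ht, -⟩ := hS ⟨P, hP⟩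
  exact isRegularLocalRing_of_span_range_eq t hd ht

/-- There are finitely many components, so their neighbourhoods can be intersected; this lets the
generators `gᵢ` be chosen independently. -/
theorem mem_wittDivisorialStalk_iff [IsDomain A] [IsIntegrallyClosed A] (p : ℕ) [Fact p.Prime] (n : ℕ)
    (D : RDivisor A) (x : PrimeSpectrum A) (φ : TruncatedWittVector p n (FractionRing A)) :
    φ ∈ wittDivisorialStalk p n D x ↔ ∀ i : Fin n, ∃ U : TopologicalSpace.Opens (PrimeSpectrum A),
      x ∈ U ∧ φ.coeff i ∈ divisorialSections ((p ^ (i : ℕ) : ℝ) • D) U := by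
  refine ⟨fun ⟨U, hx, hU⟩ i => ⟨U, hx, hU i⟩, fun h => ?_⟩
  choose U hx hU using h
  refine ⟨⨅ i, U i, ?_, fun i => divisorialSections_mono _ (iInf_le U i) (hU i)⟩
  rw [← SetLike.mem_coe, TopologicalSpace.Opens.coe_iInf]
  exact Set.mem_iInter.mpr hx

end Stalks

end WittDivisorial

theorem mainTheorem1 {p : ℕ} [Fact p.Prime] {k : Type v} [Field k] [CharP k p] [PerfectField k]
    {A : Type u} [CommRing A] [IsDomain A] [Algebra k A] (hA : IsEssentiallySmooth k A)
    (D : RDivisor A) (hD : IsSimpleNormalCrossing ((fracPart D).support : Set (PrimeDivisor A)))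
    (n : ℕ) (hn : 1 ≤ n) :
    haveI : IsNoetherianRing A := hA.isNoetherianRing
    haveI : IsIntegrallyClosed A := hA.isIntegrallyClosed
    ∀ x : PrimeSpectrum A,
      IsCohenMacaulay (TruncatedWittVector p n (Localization.AtPrime x.asIdeal))
        (wittDivisorialStalk p n D x) := by
  have : IsNoetherianRing A := hA.isNoetherianRing
  have : IsIntegrallyClosed A := hA.isIntegrallyClosed
  intro x
  have : NeZero n := ⟨Nat.one_le_iff_ne_zero.mp hn⟩
  have : CharP A p := charP_of_injective_algebraMap (algebraMap k A).injective p
  have hle := x.asIdeal.primeCompl_le_nonZeroDivisors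
  have : IsDomain (Localization.AtPrime x.asIdeal) :=
    IsLocalization.isDomain_of_le_nonZeroDivisors _ hle
  have : CharP (Localization.AtPrime x.asIdeal) p :=
    charP_of_injective_algebraMap (IsLocalization.injective _ hle : Function.Injective
      (algebraMap A (Localization.AtPrime x.asIdeal))) p
  have : CharP (FractionRing A) p :=
    charP_of_injective_algebraMap (IsFractionRing.injective A (FractionRing A)) p
  have hinj : Function.Injective
      (algebraMap (Localization.AtPrime x.asIdeal) (FractionRing A)) :=
    have := IsFractionRing.isFractionRing_of_isDomain_of_isLocalization x.asIdeal.primeCompl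
      (Localization.AtPrime x.asIdeal) (FractionRing A)
    IsFractionRing.injective _ _
  have : IsRegularRing A := isRegularRing_of_isSimpleNormalCrossing hD
  have : IsRegularRing (Localization.AtPrime x.asIdeal) := isRegularRing_localization _
  have := uniqueFactorizationMonoid_of_isRegularRing (Localization.AtPrime x.asIdeal)
  obtain ⟨d, t, hd, ht, -⟩ := hD x
  choose g hg0 hg using fun i : Fin n =>
    exists_generator_divisorialSections x ((p ^ (i : ℕ) : ℝ) • D)
  refine isCohenMacaulay_of_coeff (fun _ => rfl) hinj
    (hA.frobenius_finite_localization x.asIdeal.primeCompl) (List.ofFn t) ?_ ?_ _ g hg0 fun φ => ?_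
  · rw [← ht, Ideal.ofList]
    simp only [List.mem_ofFn, Set.range]
  · rw [hd, List.length_ofFn]
  · rw [mem_wittDivisorialStalk_iff]
    exact forall_congr' fun i => hg i _
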